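/- Cells of an $m\times n$ array ($m,n\ge 1$) are indexed by $(i,j)$ with $0\le i<m$, $0\le j<n$. An $m\times n$ Ferrers diagram $\mathcal F$ is a set of cells ("dots") such that $(i,j)\in\mathcal F$ implies $(i-1,j)\in\mathcal F$ (if $i\ge1$) and $(i,j+1)\in\mathcal F$ (if $j\le n-2$), with all $n$ cells of the first row and all $m$ cells of the last column in $\mathcal F$; a diagram with no rows or no columns is empty. An $[\mathcal F,k,\delta]_q$ code is a $k$-dimensional $\mathbb F_q$-linear subspace of $\mathbb F_q^{m\times n}$ with minimum rank distance $\delta$ (any $\delta$ is admitted for the zero code), all of whose matrices vanish outside $\mathcal F$. It is optimal if $k=\min_{0\le i\le\delta-1}v_i$, where $v_i$ is the number of dots of $\mathcal F$ that lie neither in the first $i$ rows nor in the rightmost $\delta-1-i$ columns. A Ferrers diagram $\mathcal F_{123}$ is a proper combination of Ferrers diagrams $\mathcal F_1,\mathcal F_2,\mathcal F_3$ if there are injections $\phi_l:\mathcal F_l\to\mathcal F_{123}$ with pairwise disjoint images, with $|\mathcal F_1|+|\mathcal F_2|+|\mathcal F_3|=|\mathcal F_{123}|$, and such that any two distinct dots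 of $\mathcal F_l$ in a common row or column are sent to dots in a common row or column. Construction. Let an $m\times n$ Ferrers diagram $\mathcal F$ be the disjoint union of $m_i\times n_i$ Ferrers diagrams $\mathcal F_i$ $(1\le i\le4)$, where $m=m_3+m_4$, $n=n_1+n_4$, $m_4\ge m_1+m_2$, $n_4\ge n_2+n_3$, and where $\mathcal F_1$ is placed in the top left corner, $\mathcal F_2$ with its top left cell at $(m_1,n_1)$, $\mathcal F_3$ in the bottom right corner and $\mathcal F_4$ in the top right corner. Given a proper combination $\mathcal F_{123}$ of $\mathcal F_1,\mathcal F_2,\mathcal F_3$, an $[\mathcal F_{123},k_1,\delta_1]_q$ code $\mathcal C_{123}$ and an $[\mathcal F_4,k_4,\delta_4]_q$ code $\mathcal C_4$, let $\mathcal C$ be the set of all $m\times n$ matrices obtained from some $\mathbf B\in\mathcal C_{123}$ and $\mathbf D\in\mathcal C_4$ by putting the entries of $\mathbf B$ on the cells of $\mathcal F_1,\mathcal F_2,\mathcal F_3$ (via the maps $\phi_l$), the entries of $\mathbf D$ on the cells of $\mathcal F_4$, and $0$ outside $\mathcal F$. The parameters of the construction are $k=k_1+k_4$ and $\delta=\min\{\delta_1,\delta_4\}$.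 Theorem. Let $q$ be a prime power, let $m,n,\delta\ge1$ and $\delta\le y\le\min\{m-\delta+2,\,n-\delta-1\}$. Let $\mathcal F$ be an $m\times n$ Ferrers diagram of the following shape: the first $\delta-1$ rows are full; in each of the next $y-\delta$ rows the first $n-y$ cells are empty, the last $\delta-1$ cells are dots, and the $y-\delta+1$ cells in between are arbitrary; each of the remaining $m-y+1$ rows has exactly one dot, in the last column. Let $\mathcal P$ be the set of dots of $\mathcal F$ in rows $\delta-1,\dots,y-2$ and columns $n-y,\dots,n-\delta$, and let $z_0$ be the number of dots of $\mathcal P$ in column $n-y$. If $z_0\le n-y$, then there is an optimal $[\mathcal F,k,\delta]_q$ code, where $$k=\begin{cases} m-y+1+(y-\delta)(\delta-1)+|\mathcal P| & \text{if } m-n\le\delta-2,\\ n-1+(y-\delta)(\delta-2)+|\mathcal P| & \text{otherwise.}\end{cases}$$ Moreover such a code is produced by the construction above, with these $k$ and $\delta$ as parameters, where $\mathcal F_1$ is $(\delta-1)\times(n-y)$, $\mathcal F_2$ is $z_0\times1$, $\mathcal F_3$ is $(m-y-\delta+2)\times 1$ and $\mathcal F_4$ is $(y+\delta-2)\times y$.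 -/

import Mathlib

namespace FDRM

/-- `F` is an `m × n` Ferrers diagram, as a set of cells (row, column) indexed from `0`: it is closed
under going up and going right, its first row has `n` dots and its last column has `m` dots.
For `m = 0` or `n = 0` the only such `F` is the empty diagram. -/
structure IsFerrers (m n : ℕ) (F : Finset (ℕ × ℕ)) : Prop where
  bounds : ∀ i j, (i, j) ∈ F → i < m ∧ j < n
  up : ∀ i j, (i + 1, j) ∈ F → (i, j) ∈ F
  right : ∀ i j, (i, j) ∈ F → j + 1 < n → (i, j + 1) ∈ F
  first_row : 0 < m → ∀ j < n, (0, j) ∈ F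
  last_col : 0 < n → ∀ i < m, (i, n - 1) ∈ F

/-- `C` is a `k`-dimensional linear space of `m × n` matrices with minimum rank distance `δ`.
(The zero code has no pair of distinct codewords; every `δ` is admitted for it.) -/
structure IsRankMetricCode {K : Type*} [Field K] {m n : ℕ} (k δ : ℕ)
    (C : Submodule K (Matrix (Fin m) (Fin n) K)) : Prop where
  dim : Module.finrank K C = k
  le_dist : ∀ A ∈ C, ∀ B ∈ C, A ≠ B → δ ≤ (A - B).rank
  attained : C ≠ ⊥ → ∃ A ∈ C, ∃ B ∈ C, A ≠ B ∧ (A - B).rank = δ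

/-- `C` is an `[F, k, δ]` Ferrers diagram rank-metric code, `F` an `m × n` Ferrers diagram. -/
structure IsFDRMCode {K : Type*} [Field K] {m n : ℕ} (F : Finset (ℕ × ℕ)) (k δ : ℕ)
    (C : Submodule K (Matrix (Fin m) (Fin n) K)) : Prop extends IsRankMetricCode k δ C where
  ferrers : IsFerrers m n F
  support : ∀ A ∈ C, ∀ (i : Fin m) (j : Fin n), ((i : ℕ), (j : ℕ)) ∉ F → A i j = 0

/-- The number of dots of `F` (with `n` columns) lying neither in the first `i` rows nor in the
rightmost `δ - 1 - i` columns. -/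
def boundCount (n : ℕ) (F : Finset (ℕ × ℕ)) (δ i : ℕ) : ℕ :=
  (F.filter fun c => i ≤ c.1 ∧ c.2 + (δ - 1 - i) < n).card

/-- An optimal code: its dimension attains the Singleton-like bound
`k ≤ min {boundCount n F δ i | 0 ≤ i ≤ δ - 1}`. -/
structure IsOptimalFDRMCode {K : Type*} [Field K] {m n : ℕ} (F : Finset (ℕ × ℕ)) (k δ : ℕ)
    (C : Submodule K (Matrix (Fin m) (Fin n) K)) : Prop extends IsFDRMCode F k δ C where
  optimal : IsLeast {v | ∃ i < δ, v = boundCount n F δ i} k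

/-- `F` is a proper combination of the diagrams `D l` on the mappings `φ l` (only the values of
`φ l` on `D l` matter). That `F` and the `D l` are Ferrers diagrams is required separately. -/
structure IsProperCombination {ι : Type*} [Fintype ι] (D : ι → Finset (ℕ × ℕ))
    (F : Finset (ℕ × ℕ)) (φ : ι → ℕ × ℕ → ℕ × ℕ) : Prop where
  mapsTo : ∀ l, ∀ c ∈ D l, φ l c ∈ F
  injOn : ∀ l, Set.InjOn (φ l) (D l : Set (ℕ × ℕ))
  disjoint : ∀ l l', l ≠ l' → Disjoint ((D l).image (φ l)) ((D l').image (φ l'))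
  card : ∑ l, (D l).card = F.card
  collinear : ∀ l, ∀ a ∈ D l, ∀ b ∈ D l, a ≠ b → (a.1 = b.1 ∨ a.2 = b.2) →
    ((φ l a).1 = (φ l b).1 ∨ (φ l a).2 = (φ l b).2)

/-- The diagram `D` moved down by `a` rows and right by `b` columns. -/
def shift (a b : ℕ) (D : Finset (ℕ × ℕ)) : Finset (ℕ × ℕ) :=
  D.image fun c => (c.1 + a, c.2 + b)

/-- The `m × n` Ferrers diagram `F` is composed of four Ferrers sub-diagrams, `Fᵢ` of size
`mᵢ × nᵢ`: `F₁` in the top left corner, `F₂` with its top left cell at `(m₁, n₁)`, `F₃` in the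
bottom right corner, and `F₄` in the top right corner. -/
structure IsDecomposition (m n : ℕ) (F F₁ F₂ F₃ F₄ : Finset (ℕ × ℕ))
    (m₁ n₁ m₂ n₂ m₃ n₃ m₄ n₄ : ℕ) : Prop where
  ferrers : IsFerrers m n F
  ferrers₁ : IsFerrers m₁ n₁ F₁
  ferrers₂ : IsFerrers m₂ n₂ F₂
  ferrers₃ : IsFerrers m₃ n₃ F₃
  ferrers₄ : IsFerrers m₄ n₄ F₄
  rows : m = m₃ + m₄
  cols : n = n₁ + n₄
  rows_le : m₁ + m₂ ≤ m₄
  cols_le : n₂ + n₃ ≤ n₄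
  union : F = F₁ ∪ shift m₁ n₁ F₂ ∪ shift m₄ (n - n₃) F₃ ∪ shift 0 n₁ F₄
  disjoint : Disjoint (shift m₁ n₁ F₂) (shift 0 n₁ F₄)

/-- The entry of a matrix in a cell given by natural numbers (`0` outside the matrix). -/
def entry {K : Type*} [Field K] {m n : ℕ} (A : Matrix (Fin m) (Fin n) K) (c : ℕ × ℕ) : K :=
  if h : c.1 < m ∧ c.2 < n then A ⟨c.1, h.1⟩ ⟨c.2, h.2⟩ else 0

/-- `A` is the matrix built from `B` and `D`: on the parts `F₁`, `F₂`, `F₃` of `F` it carries the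
entries of `B` transported by the maps `φ l`, on the part `F₄` the entries of `D`, and it is zero
outside `F`. -/
structure IsGluing {K : Type*} [Field K] {m n m' n' m₄ n₄ : ℕ} (F F₁ F₂ F₃ F₄ : Finset (ℕ × ℕ))
    (m₁ n₁ n₃ : ℕ) (φ : Fin 3 → ℕ × ℕ → ℕ × ℕ) (A : Matrix (Fin m) (Fin n) K)
    (B : Matrix (Fin m') (Fin n') K) (D : Matrix (Fin m₄) (Fin n₄) K) : Prop where
  on₁ : ∀ c ∈ F₁, entry A c = entry B (φ 0 c)
  on₂ : ∀ c ∈ F₂, entry A (c.1 + m₁, c.2 + n₁) = entry B (φ 1 c)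
  on₃ : ∀ c ∈ F₃, entry A (c.1 + m₄, c.2 + (n - n₃)) = entry B (φ 2 c)
  on₄ : ∀ c ∈ F₄, entry A (c.1, c.2 + n₁) = entry D c
  off : ∀ c, c ∉ F → entry A c = 0

/-- `C` is produced, as an `[F, k, δ]` code, by combining an `[F₁₂₃, k₁, δ₁]` code `C₁₂₃` and an
`[F₄, k₄, δ₄]` code `C₄`, where `F` is composed of Ferrers diagrams `F₁, F₂, F₃, F₄` of the given
sizes, the Ferrers diagram `F₁₂₃` is a proper combination of `F₁, F₂, F₃`, and
`k = k₁ + k₄`, `δ = min δ₁ δ₄`. -/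
def IsCombinedCode {K : Type*} [Field K] {m n : ℕ} (F : Finset (ℕ × ℕ)) (k δ : ℕ)
    (m₁ n₁ m₂ n₂ m₃ n₃ m₄ n₄ : ℕ) (C : Submodule K (Matrix (Fin m) (Fin n) K)) : Prop :=
  ∃ (F₁ F₂ F₃ F₄ F₁₂₃ : Finset (ℕ × ℕ)) (φ : Fin 3 → ℕ × ℕ → ℕ × ℕ) (m' n' k₁ k₄ δ₁ δ₄ : ℕ)
    (C₁₂₃ : Submodule K (Matrix (Fin m') (Fin n') K))
    (C₄ : Submodule K (Matrix (Fin m₄) (Fin n₄) K)),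
    IsDecomposition m n F F₁ F₂ F₃ F₄ m₁ n₁ m₂ n₂ m₃ n₃ m₄ n₄ ∧
    IsProperCombination ![F₁, F₂, F₃] F₁₂₃ φ ∧
    IsFDRMCode F₁₂₃ k₁ δ₁ C₁₂₃ ∧
    IsFDRMCode F₄ k₄ δ₄ C₄ ∧
    k = k₁ + k₄ ∧ δ = min δ₁ δ₄ ∧
    ∀ A, A ∈ C ↔ ∃ B ∈ C₁₂₃, ∃ D ∈ C₄, IsGluing F F₁ F₂ F₃ F₄ m₁ n₁ n₃ φ A B D

/-- The displayed shape: `F` is an `m × n` Ferrers diagram whose first `δ - 1` rows are full; in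
the next `y - δ` rows the first `n - y` columns are empty, the last `δ - 1` columns are full and
the `y - δ + 1` columns in between are free; all later rows have their only dot in the last
column. -/
structure HasShape (m n δ y : ℕ) (F : Finset (ℕ × ℕ)) : Prop where
  ferrers : IsFerrers m n F
  top : ∀ i j, i < δ - 1 → j < n → (i, j) ∈ F
  middle_left : ∀ i j, δ - 1 ≤ i → i < y - 1 → j < n - y → (i, j) ∉ F
  middle_right : ∀ i j, δ - 1 ≤ i → i < y - 1 → n - (δ - 1) ≤ j → j < n → (i, j) ∈ F
  bottom : ∀ i j, y - 1 ≤ i → i < m → ((i, j) ∈ F ↔ j = n - 1)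

/-- The sub-diagram `P` of `F` in rows `δ - 1, …, y - 2` and columns `n - y, …, n - δ`, with its
rows and columns re-indexed from `0`. -/
def subP (n δ y : ℕ) (F : Finset (ℕ × ℕ)) : Finset (ℕ × ℕ) :=
  (Finset.range (y - δ) ×ˢ Finset.range (y - δ + 1)).filter
    fun c => (c.1 + (δ - 1), c.2 + (n - y)) ∈ F

/-- The number of dots in column `j` of `P`. -/
def colCount (P : Finset (ℕ × ℕ)) (j : ℕ) : ℕ := (P.filter fun c => c.2 = j).card

end FDRM

/-! Write `d = δ - 1`, `N = y - 1`, `a = n - y`, `c = m - N - d`, and `z` for the number of dots of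
the first column of `P`. The diagram splits into a `d × a` rectangle `F₁`, a column `F₂` of `z`
dots, the tail `F₃` of `c` dots in the last column, and a corner `F₄`. Both component codes consist
of values of `q`-polynomials at independent points of an extension `L` of degree `a` or `N`
(Gabidulin codes), in systematic form: the values at the first points are free and serve as
information (`exists_gabidulin`).

On `F₁₂₃`, `q`-polynomials with two coefficients are used. A nonzero one kills at most a line, so
its values at `d + 2` points span at least `d + 1` dimensions. Two values are information and sit on
the lines `F₂`, `F₃`; the other `d` fill the rectangle. Hence the rectangle has rank at least `d +
1` minus the number of nonzero lines (`exists_code_of_rect_add_lines`). In the glued matrix the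
columns `F₂` and `F₃` form a staircase below the rectangle, so each nonzero one restores a unit of
rank, whatever stands on `F₄` (`rank_add_le_rank_glue`).

On `F₄`, polynomials `f` with `N - d + 1` coefficients have rank only at least `d`, and the long
last column supplies the missing unit (`exists_code_of_long_last_col`). Its bottom `d` cells repeat
the first column `f(1)`, which settles `f(1) ≠ 0`. If `f(1) = 0`, then `f = g ∘ (X ^ q - X)` with
one coefficient fewer in `g`; the upper part of the last column is `g(w)` for a `w` outside the
image of `X ^ q - X`, so the columns span all of `g(L)`, of dimension at least `d + 1`.

The total dimension meets the Singleton-like bound at `i = d` if `c ≤ a` and at `i = d - 1`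
otherwise. It exceeds a bound for distance `d + 2`, so the distance is exactly `d + 1`. -/

namespace FDRM

/-! ### Linearized polynomials over a finite field. -/

/-- The `q`-polynomial `∑ i, a i * X ^ (q ^ i)` as a linear endomorphism of the extension `L`
of the field `K` with `q` elements. -/
noncomputable def qPoly (K L : Type*) [Field K] [Fintype K] [Field L] [Algebra K L] (s : ℕ) :
    (Fin s → L) →ₗ[K] L →ₗ[K] L :=
  ∑ i : Fin s, (LinearMap.lcomp K L ((FiniteField.frobeniusAlgHom K L ^ (i : ℕ)).toLinearMap)) ∘ₗ
    (LinearMap.mul K L) ∘ₗ (LinearMap.proj i)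

section qPoly
variable {K L : Type*} [Field K] [Fintype K] [Field L] [Algebra K L]

theorem frobenius_pow_apply (i : ℕ) (x : L) :
    (FiniteField.frobeniusAlgHom K L ^ i) x = x ^ Fintype.card K ^ i := by
  induction i generalizing x with
  | zero => simp
  | succ i ih => rw [pow_succ, AlgHom.mul_apply, ih]; simp [← pow_mul, pow_succ']

theorem qPoly_apply (s : ℕ) (a : Fin s → L) (x : L) :
    qPoly K L s a x = ∑ i : Fin s, a i * x ^ Fintype.card K ^ (i : ℕ) := by
  simp [qPoly, frobenius_pow_apply]

/-- The kernel consists of roots of a nonzero polynomial of degree at most `q ^ (s - 1)`, so it has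
at most that many elements. -/
theorem finrank_ker_qPoly_lt [FiniteDimensional K L] (s : ℕ) (a : Fin s → L) (ha : a ≠ 0) :
    Module.finrank K (LinearMap.ker (qPoly K L s a)) < s := by
  classical
  set q := Fintype.card K with hq
  have hq1 : 1 < q := Fintype.one_lt_card
  set p : Polynomial L := ∑ i : Fin s, Polynomial.monomial (q ^ (i : ℕ)) (a i) with hp
  have hs : 0 < s := by
    rcases Nat.eq_zero_or_pos s with rfl | h
    · exact absurd (Subsingleton.elim _ _) ha
    · exact h
  have hp0 : p ≠ 0 := by
    intro h
    apply ha
    funext i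
    have := congrArg (fun r => Polynomial.coeff r (q ^ (i : ℕ))) h
    simpa [hp, Polynomial.finsetSum_coeff, Polynomial.coeff_monomial,
      Nat.pow_right_inj hq1, Fin.val_inj] using this
  have hdeg : p.natDegree ≤ q ^ (s - 1) := by
    refine Polynomial.natDegree_sum_le_of_forall_le _ _ fun i _ => ?_
    refine (Polynomial.natDegree_monomial_le _).trans ?_
    exact Nat.pow_le_pow_right hq1.le (by have := i.isLt; omega)
  have : Fintype (LinearMap.ker (qPoly K L s a)) :=
    have := Module.finite_of_finite K (M := L)
    Fintype.ofFinite _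
  have hcard := Module.card_eq_pow_finrank (K := K) (V := LinearMap.ker (qPoly K L s a))
  have hle : Fintype.card (LinearMap.ker (qPoly K L s a)) ≤ q ^ (s - 1) := by
    refine le_trans ?_ hdeg
    refine le_trans ?_ (Polynomial.card_roots' p)
    refine le_trans ?_ (Multiset.toFinset_card_le _)
    rw [← Finset.card_univ]
    refine Finset.card_le_card_of_injOn (fun x => (x : L)) ?_ (Subtype.val_injective.injOn)
    intro x _
    have hx := x.2
    rw [LinearMap.mem_ker, qPoly_apply] at hx
    have hroot : (x : L) ∈ p.roots := by
      rw [Polynomial.mem_roots hp0, Polynomial.IsRoot.def, hp, Polynomial.eval_finsetSum]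
      simpa only [Polynomial.eval_monomial] using hx
    simpa using hroot
  rw [hcard] at hle
  have := (Nat.pow_le_pow_iff_right hq1).1 hle
  omega

theorem finrank_le_finrank_map_qPoly [FiniteDimensional K L] (s : ℕ) (a : Fin s → L) (ha : a ≠ 0)
    (U : Submodule K L) :
    Module.finrank K U + 1 ≤ Module.finrank K (U.map (qPoly K L s a)) + s := by
  have h1 : Module.finrank K (LinearMap.range ((qPoly K L s a).domRestrict U)) +
      Module.finrank K (LinearMap.ker ((qPoly K L s a).domRestrict U)) = Module.finrank K U :=
    LinearMap.finrank_range_add_finrank_ker _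
  have h2 := finrank_ker_qPoly_lt (K := K) s a ha
  rw [LinearMap.range_domRestrict] at h1
  have h3 : Module.finrank K (LinearMap.ker ((qPoly K L s a).domRestrict U)) ≤
      Module.finrank K (LinearMap.ker (qPoly K L s a)) := by
    rw [(Submodule.equivMapOfInjective U.subtype U.subtype_injective
      (LinearMap.ker ((qPoly K L s a).domRestrict U))).finrank_eq]
    refine Submodule.finrank_mono ?_
    rintro _ ⟨x, hx, rfl⟩
    simpa using hx
  omega

/-- If `f = ∑ a i X ^ (q ^ i)` vanishes at `1`, this is the `q`-polynomial `g` with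
`f = g ∘ (X ^ q - X)`. -/
noncomputable def qQuot (K L : Type*) [Field K] [Field L] [Algebra K L] (r : ℕ) :
    (Fin (r + 1) → L) →ₗ[K] (Fin r → L) :=
  LinearMap.pi fun i => ∑ j ∈ Finset.univ.filter (fun j => i ≤ j), LinearMap.proj (j : Fin r).succ

/-- Vanishing at `1` means that the coefficients sum to zero, so `f` is a combination of the `X ^ q
^ (j + 1) - X`. Each of these telescopes into the Frobenius powers of `X ^ q - X`. -/
theorem qPoly_qQuot (r : ℕ) (a : Fin (r + 1) → L) (h : qPoly K L _ a 1 = 0) (x : L) :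
    qPoly K L r (qQuot K L r a) (x ^ Fintype.card K - x) = qPoly K L (r + 1) a x := by
  set q := Fintype.card K
  have hsub : ∀ i : ℕ, (x ^ q - x) ^ q ^ i = x ^ q ^ (i + 1) - x ^ q ^ i := by
    intro i
    rw [← frobenius_pow_apply (K := K), map_sub, frobenius_pow_apply, frobenius_pow_apply,
      ← pow_mul, ← pow_succ']
  have h0 : a 0 = - ∑ j : Fin r, a j.succ := by
    rw [qPoly_apply] at h
    simp only [one_pow, mul_one, Fin.sum_univ_succ] at h
    linear_combination h
  rw [qPoly_apply, qPoly_apply, Fin.sum_univ_succ, h0]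
  have hx : ∀ i : Fin r, qQuot K L r a i * (x ^ q - x) ^ q ^ (i : ℕ) =
      ∑ j : Fin r, if (i : ℕ) ≤ j then a j.succ * (x ^ q ^ ((i : ℕ) + 1) - x ^ q ^ (i : ℕ))
        else 0 := by
    intro i
    rw [hsub, qQuot, LinearMap.pi_apply, LinearMap.sum_apply, Finset.sum_mul, Finset.sum_filter]
    rfl
  rw [Finset.sum_congr rfl fun i _ => hx i, Finset.sum_comm]
  simp only [Fin.val_zero, pow_zero, pow_one, Fin.val_succ, neg_mul, Finset.sum_mul]
  rw [neg_add_eq_sub, ← Finset.sum_sub_distrib]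
  refine Finset.sum_congr rfl fun j _ => ?_
  rw [Fin.sum_univ_eq_sum_range
    (fun i => if i ≤ (j : ℕ) then a j.succ * (x ^ q ^ (i + 1) - x ^ q ^ i) else 0) r,
    ← Finset.sum_filter, ← mul_sub]
  have hr : (Finset.range r).filter (fun i => i ≤ (j : ℕ)) = Finset.range ((j : ℕ) + 1) := by
    ext i; have := j.isLt; simp only [Finset.mem_filter, Finset.mem_range]; omega
  rw [hr, ← Finset.mul_sum, Finset.sum_range_sub (fun i => x ^ q ^ i)]
  simp [q]

end qPoly

/-! ### Systematic Gabidulin codes with an extra column. -/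

/-- `Ev v` lists the values of a polynomial `f` with `r + 1` coefficients at `N` independent points,
in coordinates over `K`; `v` prescribes the first `r + 1` values. The first point is `1`, so `v (0,
·) = 0` says `f(1) = 0`, and `T v` is the value at `w` of the quotient of `f` by `X ^ q - X`. `T` is
defined on every `v`, also where that quotient has no meaning, in order to be linear. -/
theorem exists_gabidulin (K : Type*) [Field K] [Finite K] (N r : ℕ) (hr : r + 1 ≤ N) :
    ∃ (Ev : (Fin (r + 1) × Fin N → K) →ₗ[K] (Fin N → Fin N → K))
      (T : (Fin (r + 1) × Fin N → K) →ₗ[K] (Fin N → K)),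
      (∀ v j i, Ev v (Fin.castLE hr j) i = v (j, i)) ∧
      (∀ v, v ≠ 0 → ∀ t : Finset (Fin N),
        t.card ≤ Module.finrank K (Submodule.span K (Ev v '' t)) + r) ∧
      (∀ v, v ≠ 0 → (∀ i, v (0, i) = 0) →
        N + 1 ≤ Module.finrank K (Submodule.span K (insert (T v) (Set.range (Ev v)))) + r) := by
  classical
  have : Fintype K := Fintype.ofFinite K
  obtain ⟨p, hp⟩ := CharP.exists K
  have : Fact p.Prime := ⟨(CharP.char_is_prime_or_zero K p).resolve_right
    (CharP.char_ne_zero_of_finite K p)⟩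
  have : NeZero N := ⟨by omega⟩
  set L := FiniteField.Extension K p N
  have hN : Module.finrank K L = N := FiniteField.finrank_extension K p N
  let b : Module.Basis (Fin N) K L := Module.finBasisOfFinrankEq K L hN
  have hb0 : b 0 ≠ 0 := b.ne_zero 0
  let x : Fin N → L := fun i => (b 0)⁻¹ * b i
  have hx0 : x 0 = 1 := inv_mul_cancel₀ hb0
  have hxli : LinearIndependent K x :=
    b.linearIndependent.map' (LinearMap.mulLeft K (b 0)⁻¹)
      (LinearMap.ker_eq_bot.2 (mul_right_injective₀ (inv_ne_zero hb0)))
  have hxcard : ∀ t : Finset (Fin N), Module.finrank K (Submodule.span K (x '' t)) = t.card := by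
    intro t
    have := finrank_span_eq_card (hxli.comp (fun i : t => (i : Fin N)) Subtype.val_injective)
    have ht : Set.range (fun i : t => (i : Fin N)) = t := by ext; simp
    rwa [Fintype.card_coe, Set.range_comp, ht] at this
  have hxtop : Submodule.span K (Set.range x) = ⊤ := by
    apply Submodule.eq_top_of_finrank_eq
    rw [finrank_span_eq_card hxli, hN, Fintype.card_fin]
  let E : (Fin (r + 1) → L) →ₗ[K] (Fin (r + 1) → L) :=
    LinearMap.pi fun j => (LinearMap.applyₗ (x (Fin.castLE hr j))) ∘ₗ qPoly K L (r + 1)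
  -- Interpolation: a nonzero `f` with `r + 1` coefficients cannot vanish on the `r + 1` dimensions
  -- spanned by the first points.
  have hE : Function.Injective E := by
    rw [← LinearMap.ker_eq_bot, LinearMap.ker_eq_bot']
    intro a ha
    by_contra hne
    have h := finrank_le_finrank_map_qPoly _ a hne
      (Submodule.span K (x '' (Finset.univ.image (Fin.castLE hr))))
    rw [hxcard, Finset.card_image_of_injective _ (Fin.castLE_injective hr), Finset.card_univ,
      Fintype.card_fin, Submodule.map_span] at h
    have h0 : Submodule.span K ((qPoly K L (r + 1) a) '' (x '' (Finset.univ.image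
        (Fin.castLE hr)))) = ⊥ := by
      rw [Submodule.span_eq_bot]
      rintro _ ⟨_, ⟨j, hj, rfl⟩, rfl⟩
      simp only [Finset.coe_image, Finset.coe_univ, Set.image_univ, Set.mem_range] at hj
      obtain ⟨j, rfl⟩ := hj
      exact congrFun ha j
    rw [h0, finrank_bot] at h
    omega
  let e := LinearEquiv.ofInjectiveEndo E hE
  let dec : (Fin (r + 1) × Fin N → K) →ₗ[K] (Fin (r + 1) → L) :=
    LinearMap.pi fun j => b.equivFun.symm.toLinearMap ∘ₗ LinearMap.funLeft K K (fun i => (j, i))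
  have hdec : ∀ v j, b.equivFun (dec v j) = fun i => v (j, i) := by
    intro v j
    exact LinearEquiv.apply_symm_apply _ _
  let co := e.symm.toLinearMap ∘ₗ dec
  have hco : ∀ v j, qPoly K L (r + 1) (co v) (x (Fin.castLE hr j)) = dec v j := by
    intro v j
    exact congrFun (LinearEquiv.apply_symm_apply e (dec v)) j
  have hco0 : ∀ v, v ≠ 0 → co v ≠ 0 := by
    intro v hv h
    apply hv
    funext ⟨j, i⟩
    have h1 := hdec v j
    rw [← hco, h] at h1
    simpa using (congrFun h1 i).symm
  let h1 : L →ₗ[K] L := qPoly K L 2 ![-1, 1]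
  have hh1 : ∀ z, h1 z = z ^ Fintype.card K - z := by
    intro z
    simp only [h1, qPoly_apply, Fin.sum_univ_two]
    simp
    ring
  have hker := finrank_ker_qPoly_lt (K := K) (L := L) 2 ![-1, 1]
    (fun h => by simpa using congrFun h 1)
  have hrk : Module.finrank K (LinearMap.range h1) + Module.finrank K (LinearMap.ker h1) =
    Module.finrank K L := LinearMap.finrank_range_add_finrank_ker h1
  -- The map `X ^ q - X` kills `1`, so it is not surjective. Its kernel is at most a line, so a
  -- single `w` completes its range to `L`.
  obtain ⟨w, hw⟩ : ∃ w, w ∉ LinearMap.range h1 := by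
    by_contra! hall
    have hs : Function.Surjective h1 := fun z => hall z
    have hi := LinearMap.injective_iff_surjective.2 hs
    have : (1 : L) = 0 := hi (by rw [hh1, map_zero]; simp)
    exact one_ne_zero this
  have htop : LinearMap.range h1 ⊔ Submodule.span K {w} = ⊤ := by
    have hlt : LinearMap.range h1 < LinearMap.range h1 ⊔ Submodule.span K {w} := by
      refine lt_of_le_of_ne le_sup_left fun h => hw ?_
      rw [h]
      exact Submodule.mem_sup_right (Submodule.mem_span_singleton_self w)
    have := Submodule.finrank_lt_finrank_of_lt hlt
    apply Submodule.eq_top_of_finrank_eq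
    have := Submodule.finrank_le (LinearMap.range h1 ⊔ Submodule.span K {w})
    change Module.finrank K (LinearMap.ker h1) < 2 at hker
    omega
  refine ⟨LinearMap.pi fun j => b.equivFun.toLinearMap ∘ₗ LinearMap.applyₗ (x j) ∘ₗ
      qPoly K L (r + 1) ∘ₗ co,
    b.equivFun.toLinearMap ∘ₗ LinearMap.applyₗ w ∘ₗ qPoly K L r ∘ₗ qQuot K L r ∘ₗ co,
    ?_, ?_, ?_⟩
  · intro v j i
    have := congrFun (hdec v j) i
    rw [← hco] at this
    exact this
  · intro v hv t
    have h := finrank_le_finrank_map_qPoly _ (co v) (hco0 v hv) (Submodule.span K (x '' t))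
    rw [hxcard, Submodule.map_span, ← LinearEquiv.finrank_map_eq b.equivFun, Submodule.map_span,
      Set.image_image, Set.image_image] at h
    exact Nat.le_of_succ_le_succ h
  · intro v hv hv0
    have hf1 : qPoly K L (r + 1) (co v) 1 = 0 := by
      have h0 := hco v 0
      have : Fin.castLE hr 0 = (0 : Fin N) := rfl
      rw [this, hx0] at h0
      rw [h0]
      apply b.equivFun.injective
      rw [hdec, map_zero]
      funext i
      exact hv0 i
    set g := qQuot K L r (co v) with hg
    have hfg := qPoly_qQuot r (co v) hf1
    have hg0 : g ≠ 0 := by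
      intro h
      have hz := finrank_ker_qPoly_lt (K := K) _ (co v) (hco0 v hv)
      have : LinearMap.ker (qPoly K L (r + 1) (co v)) = ⊤ := by
        rw [LinearMap.ker_eq_top]
        ext z
        rw [← hfg, ← hg, h]
        simp
      rw [this, finrank_top, hN] at hz
      omega
    have h := finrank_le_finrank_map_qPoly (K := K) _ g hg0 ⊤
    rw [finrank_top, hN, ← htop] at h
    set f := qPoly K L (r + 1) (co v)
    -- On the range of `X ^ q - X` the map `g` takes exactly the values of `f`, which the `f (x j)`
    -- span; only `g(w)` has to be added to reach `g(L)`.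
    have hle : (LinearMap.range h1 ⊔ Submodule.span K {w}).map (qPoly K L r g) ≤
        Submodule.span K (insert (qPoly K L r g w) (Set.range fun j => f (x j))) := by
      rw [Submodule.map_sup, sup_le_iff]
      constructor
      · rintro _ ⟨_, ⟨z, rfl⟩, rfl⟩
        rw [hh1, hfg]
        refine Submodule.span_mono (Set.subset_insert _ _) ?_
        have hz : z ∈ Submodule.span K (Set.range x) := hxtop ▸ Submodule.mem_top
        have := Submodule.mem_map_of_mem (f := f) hz
        rwa [Submodule.map_span, ← Set.range_comp] at this
      · rw [Submodule.map_span, Set.image_singleton]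
        exact Submodule.span_mono (by simp)
    have hle2 := Submodule.finrank_mono hle
    rw [← LinearEquiv.finrank_map_eq b.equivFun
      (Submodule.span K (insert (qPoly K L r g w) _)), Submodule.map_span,
      Set.image_insert_eq, ← Set.range_comp] at hle2
    exact h.trans (Nat.add_le_add_right hle2 r)

/-! ### Rank estimates and the Singleton-like bound. -/

section rank
variable {K : Type*} [Field K]

/-- The matrix is the sum of a part living in `i` rows and a part living in `t` columns. -/
theorem rank_le_add_of_support {m n : ℕ} (A : Matrix (Fin m) (Fin n) K) (i t : ℕ)
    (h : ∀ (r : Fin m) (c : Fin n), i ≤ (r : ℕ) → (c : ℕ) + t < n → A r c = 0) :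
    A.rank ≤ i + t := by
  classical
  let A₁ : Matrix (Fin m) (Fin n) K := Matrix.of fun r c => if (r : ℕ) < i then A r c else 0
  let A₂ : Matrix (Fin m) (Fin n) K := Matrix.of fun r c => if (r : ℕ) < i then 0 else A r c
  have hA : A = A₁ + A₂ := by
    ext r c
    simp only [A₁, A₂, Matrix.add_apply, Matrix.of_apply]
    split_ifs <;> simp
  have h₁ : A₁.rank ≤ i := by
    refine (A₁.rank_le_card_of_support_subset (Finset.univ.filter fun r => (r : ℕ) < i) ?_).trans ?_
    · intro r hr
      by_contra hc
      simp only [Finset.coe_filter, Finset.mem_univ, true_and, Set.mem_ofPred_eq] at hc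
      exact hr (funext fun c => by simp [A₁, hc])
    · calc _ = ((Finset.univ.filter fun r : Fin m => (r : ℕ) < i).image Fin.val).card :=
            (Finset.card_image_of_injective _ Fin.val_injective).symm
        _ ≤ (Finset.range i).card := Finset.card_le_card (by intro; simp; omega)
        _ = i := Finset.card_range i
  have h₂ : A₂.rank ≤ t := by
    rw [← Matrix.rank_transpose]
    refine (A₂.transpose.rank_le_card_of_support_subset
      (Finset.univ.filter fun c => n ≤ (c : ℕ) + t) ?_).trans ?_
    · intro c hc
      by_contra hn
      simp only [Finset.coe_filter, Finset.mem_univ, true_and, Set.mem_ofPred_eq] at hn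
      refine hc (funext fun r => ?_)
      simp only [Matrix.row, Matrix.transpose_apply, A₂, Matrix.of_apply, Pi.zero_apply]
      split_ifs with hr
      · rfl
      · exact h r c (by omega) (by omega)
    · calc _ = ((Finset.univ.filter fun c : Fin n => n ≤ (c : ℕ) + t).image Fin.val).card :=
            (Finset.card_image_of_injective _ Fin.val_injective).symm
        _ ≤ (Finset.Ico (n - t) n).card := Finset.card_le_card (by intro; simp; omega)
        _ ≤ t := by rw [Nat.card_Ico]; omega
  rw [hA]
  refine le_trans ?_ (Nat.add_le_add h₁ h₂)
  refine le_trans (Submodule.finrank_mono (t := LinearMap.range A₁.mulVecLin ⊔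
    LinearMap.range A₂.mulVecLin) ?_) (Submodule.finrank_add_le_finrank_add_finrank _ _)
  rintro _ ⟨v, rfl⟩
  rw [Matrix.mulVecLin_add]
  exact Submodule.add_mem_sup ⟨v, rfl⟩ ⟨v, rfl⟩

/-- `entry` as a linear functional. -/
noncomputable def entryHom (K : Type*) [Field K] (m n : ℕ) (c : ℕ × ℕ) :
    Matrix (Fin m) (Fin n) K →ₗ[K] K where
  toFun A := entry A c
  map_add' A B := by unfold entry; split_ifs <;> simp
  map_smul' a A := by unfold entry; split_ifs <;> simp

@[simp] theorem entryHom_apply {m n : ℕ} (c : ℕ × ℕ) (A : Matrix (Fin m) (Fin n) K) :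
    entryHom K m n c A = entry A c := rfl

theorem entry_fin {m n : ℕ} (A : Matrix (Fin m) (Fin n) K) (i : Fin m) (j : Fin n) :
    entry A ((i : ℕ), (j : ℕ)) = A i j := by
  simp [entry]

/-- The Singleton-like bound on Ferrers diagram rank-metric codes. -/
theorem finrank_le_boundCount {m n : ℕ} {F : Finset (ℕ × ℕ)} {δ i : ℕ} (hi : i < δ)
    (C : Submodule K (Matrix (Fin m) (Fin n) K))
    (hs : ∀ A ∈ C, ∀ (i : Fin m) (j : Fin n), ((i : ℕ), (j : ℕ)) ∉ F → A i j = 0)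
    (hC : ∀ A ∈ C, A ≠ 0 → δ ≤ A.rank) :
    Module.finrank K C ≤ boundCount n F δ i := by
  unfold boundCount
  set S := F.filter fun c => i ≤ c.1 ∧ c.2 + (δ - 1 - i) < n with hS
  -- A codeword that vanishes on all counted cells is covered by `i` rows and `δ - 1 - i` columns,
  -- so its rank is below `δ` and it is zero.
  let f : C →ₗ[K] (S → K) := LinearMap.pi fun c => entryHom K m n c ∘ₗ C.subtype
  have hf : Function.Injective f := by
    rw [← LinearMap.ker_eq_bot, LinearMap.ker_eq_bot']
    rintro ⟨A, hA⟩ h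
    by_contra hne
    have hr := hC A hA (fun h0 => hne (by simpa using h0))
    have := rank_le_add_of_support A i (δ - 1 - i) fun r c hr hc => by
      by_cases hF : ((r : ℕ), (c : ℕ)) ∈ F
      · have := congrFun h ⟨_, Finset.mem_filter.2 ⟨hF, hr, hc⟩⟩
        exact (entry_fin A r c).symm.trans this
      · exact hs A hA r c hF
    omega
  have := LinearMap.finrank_le_finrank_of_injective hf
  rwa [Module.finrank_fintype_fun_eq_card, Fintype.card_coe] at this

/-- Codes are required to attain their distance. For the code on `F₁₂₃` only a lower bound is
needed, and its true distance may be larger; the zero code takes the bound itself as its distance.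
-/
theorem exists_isRankMetricCode {m n : ℕ} (δ : ℕ) (C : Submodule K (Matrix (Fin m) (Fin n) K))
    (hC : ∀ A ∈ C, A ≠ 0 → δ ≤ A.rank) :
    ∃ δ', δ ≤ δ' ∧ IsRankMetricCode (Module.finrank K C) δ' C := by
  classical
  by_cases h : C = ⊥
  · refine ⟨δ, le_rfl, rfl, ?_, fun h' => absurd h h'⟩
    subst h
    intro A hA B hB hAB
    rw [Submodule.mem_bot] at hA hB
    exact absurd (hA.trans hB.symm) hAB
  · obtain ⟨A₀, hA₀, hne₀⟩ := Submodule.exists_mem_ne_zero_of_ne_bot h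
    have hex : ∃ d, ∃ A ∈ C, A ≠ 0 ∧ A.rank = d := ⟨_, A₀, hA₀, hne₀, rfl⟩
    obtain ⟨A₁, hA₁, hne₁, hr₁⟩ := Nat.find_spec hex
    refine ⟨Nat.find hex, hr₁ ▸ hC A₁ hA₁ hne₁, rfl, ?_, fun _ => ?_⟩
    · intro A hA B hB hAB
      exact Nat.find_min' hex ⟨A - B, C.sub_mem hA hB, sub_ne_zero.2 hAB, rfl⟩
    · exact ⟨A₁, hA₁, 0, C.zero_mem, hne₁, by simpa using hr₁⟩

/-- A code of minimum distance at least `δ` whose dimension exceeds one of the Singleton-like bounds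
for distance `δ + 1` has minimum distance exactly `δ`. -/
theorem isFDRMCode_of_boundCount_lt {m n : ℕ} {F : Finset (ℕ × ℕ)} {k δ i : ℕ}
    (hF : IsFerrers m n F) (C : Submodule K (Matrix (Fin m) (Fin n) K))
    (hk : Module.finrank K C = k)
    (hs : ∀ A ∈ C, ∀ (i : Fin m) (j : Fin n), ((i : ℕ), (j : ℕ)) ∉ F → A i j = 0)
    (hC : ∀ A ∈ C, A ≠ 0 → δ ≤ A.rank) (hi : i ≤ δ) (hb : boundCount n F (δ + 1) i < k) :
    IsFDRMCode F k δ C where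
  dim := hk
  le_dist A hA B hB hAB := hC _ (C.sub_mem hA hB) (sub_ne_zero.2 hAB)
  attained _ := by
    by_contra hcon
    have := finrank_le_boundCount (δ := δ + 1) (i := i) (by omega) C hs fun A hA hne => by
      have h1 := hC A hA hne
      have h2 : A.rank ≠ δ := fun h => hcon ⟨A, hA, 0, C.zero_mem, hne, by simpa using h⟩
      omega
    omega
  ferrers := hF
  support := hs

theorem IsFDRMCode.isOptimal {m n : ℕ} {F : Finset (ℕ × ℕ)} {k δ i : ℕ}
    {C : Submodule K (Matrix (Fin m) (Fin n) K)} (h : IsFDRMCode F k δ C) (hi : i < δ)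
    (hk : k = boundCount n F δ i) : IsOptimalFDRMCode F k δ C where
  toIsFDRMCode := h
  optimal := by
    refine ⟨⟨i, hi, hk⟩, ?_⟩
    rintro _ ⟨j, hj, rfl⟩
    rw [← h.dim]
    refine finrank_le_boundCount hj C h.support fun A hA hne => ?_
    simpa using h.le_dist A hA 0 C.zero_mem hne

theorem finrank_add_one_le_sup {V : Type*} [AddCommGroup V] [Module K V] [FiniteDimensional K V]
    (X : Submodule K V) (v : V) (φ : V →ₗ[K] K) (hX : ∀ x ∈ X, φ x = 0) (hv : φ v ≠ 0) :
    Module.finrank K X + 1 ≤ Module.finrank K ↥(X ⊔ Submodule.span K {v}) := by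
  refine Submodule.finrank_lt_finrank_of_lt (lt_of_le_of_ne le_sup_left fun h => ?_)
  refine hv (hX v ?_)
  rw [h]
  exact Submodule.mem_sup_right (Submodule.mem_span_singleton_self v)

theorem finrank_sup_span_singleton_le {V : Type*} [AddCommGroup V] [Module K V]
    [FiniteDimensional K V] [DecidableEq V] (X : Submodule K V) (v : V) :
    Module.finrank K ↥(X ⊔ Submodule.span K {v}) ≤
      Module.finrank K X + if v = 0 then 0 else 1 := by
  split_ifs with h
  · subst h
    have : X ⊔ Submodule.span K {(0 : V)} = X := by simp
    rw [this, add_zero]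
  · have := Submodule.finrank_add_le_finrank_add_finrank X (Submodule.span K {v})
    rwa [finrank_span_singleton h] at this

theorem exists_finrank_eq_card {ι : Type*} [Fintype ι] (s : Finset ι) :
    ∃ U : Submodule K (ι → K), Module.finrank K U = s.card ∧
      ∀ f, f ∈ U ↔ ∀ i, i ∉ s → f i = 0 := by
  classical
  refine ⟨⨅ i ∈ (s : Set ι)ᶜ, LinearMap.ker (LinearMap.proj i), ?_, ?_⟩
  · have := LinearMap.iInfKerProjEquiv K (fun _ : ι => K) (I := (s : Set ι))
      (J := (s : Set ι)ᶜ) disjoint_compl_right (by simp)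
    have h := this.finrank_eq
    rw [Module.finrank_fintype_fun_eq_card] at h
    simpa using h
  · intro f
    simp

theorem finrank_le_rank {m n : ℕ} (A : Matrix (Fin m) (Fin n) K) (X : Submodule K (Fin m → K))
    (h : X ≤ Submodule.span K (Set.range A.col)) : Module.finrank K X ≤ A.rank := by
  rw [Matrix.rank_eq_finrank_span_cols]
  exact Submodule.finrank_mono h

theorem rank_le_finrank {m n : ℕ} (A : Matrix (Fin m) (Fin n) K) (X : Submodule K (Fin m → K))
    (h : ∀ j, A.col j ∈ X) : A.rank ≤ Module.finrank K X := by
  rw [Matrix.rank_eq_finrank_span_cols]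
  refine Submodule.finrank_mono (Submodule.span_le.2 ?_)
  rintro _ ⟨j, rfl⟩
  exact h j

end rank

/-! ### The code on the corner diagram. -/

/-- With `r = N - d`, columns `0, …, r` carry the information, restricted to the dots of `F`. The
check columns after them are unrestricted because `F` is full there in the first `N` rows. The first
column has dots only in its first `d` rows, so the `d` bottom cells of the last column can hold a
complete copy of it. -/
theorem exists_code_of_long_last_col (K : Type*) [Field K] [Finite K] (N d : ℕ) (hd : 1 ≤ d)
    (hdN : d ≤ N) (F : Finset (ℕ × ℕ)) (hF : IsFerrers (N + d) (N + 1) F)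
    (h0 : ∀ i, (i, 0) ∈ F → i < d) (h1 : ∀ i j, (i, j) ∈ F → j < N → i < N)
    (h2 : ∀ i j, i < N → N - d < j → j < N → (i, j) ∈ F) :
    ∃ C : Submodule K (Matrix (Fin (N + d)) (Fin (N + 1)) K),
      IsFDRMCode F (F.filter fun c => c.2 ≤ N - d).card (d + 1) C := by
  classical
  obtain ⟨r, hrdef⟩ : ∃ r, N - d = r := ⟨_, rfl⟩
  rw [hrdef] at h2 ⊢
  have hr : r + 1 ≤ N := by omega
  obtain ⟨Ev, T, hsys, hEv, hT⟩ := exists_gabidulin K N r hr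
  obtain ⟨U, hUdim, hU⟩ := exists_finrank_eq_card (K := K)
    (Finset.univ.filter fun p : Fin (r + 1) × Fin N => ((p.2 : ℕ), (p.1 : ℕ)) ∈ F)
  have hcard : (Finset.univ.filter fun p : Fin (r + 1) × Fin N =>
      ((p.2 : ℕ), (p.1 : ℕ)) ∈ F).card = (F.filter fun c => c.2 ≤ r).card := by
    refine Finset.card_bij (fun p _ => ((p.2 : ℕ), (p.1 : ℕ))) ?_ ?_ ?_
    · intro p hp
      have := p.1.isLt
      simp only [Finset.mem_filter, Finset.mem_univ, true_and] at hp ⊢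
      exact ⟨hp, by omega⟩
    · rintro ⟨a, b⟩ _ ⟨a', b'⟩ _ h
      simp only [Prod.mk.injEq, Fin.val_inj] at h
      rw [h.1, h.2]
    · rintro ⟨i, j⟩ hc
      simp only [Finset.mem_filter] at hc
      exact ⟨(⟨j, by omega⟩, ⟨i, h1 i j hc.1 (by omega)⟩), by simpa using hc.1, rfl⟩
  simp only [Finset.mem_filter, Finset.mem_univ, true_and] at hU
  let D : (Fin (r + 1) × Fin N → K) →ₗ[K] Matrix (Fin (N + d)) (Fin (N + 1)) K :=
    { toFun := fun v => Matrix.of fun i j =>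
        if hj : (j : ℕ) < N then
          (if hi : (i : ℕ) < N then Ev v ⟨j, hj⟩ ⟨i, hi⟩ else 0)
        else if hi : (i : ℕ) < N then T v ⟨i, hi⟩ else v (0, ⟨i - N, by omega⟩)
      map_add' := fun v w => by
        ext i j
        simp only [map_add, Matrix.of_apply, Matrix.add_apply, Pi.add_apply]
        split_ifs <;> simp
      map_smul' := fun a v => by
        ext i j
        simp only [map_smul, Matrix.of_apply, Matrix.smul_apply, Pi.smul_apply, RingHom.id_apply]
        split_ifs <;> simp }
  have hDin : ∀ v (i : Fin (N + d)) (j : Fin (N + 1)) (hj : (j : ℕ) < N) (hi : (i : ℕ) < N),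
      D v i j = Ev v ⟨j, hj⟩ ⟨i, hi⟩ := by
    intro v i j hj hi
    simp only [D, LinearMap.coe_mk, AddHom.coe_mk, Matrix.of_apply, dif_pos hj, dif_pos hi]
  have hDzero : ∀ v (i : Fin (N + d)) (j : Fin (N + 1)) (_ : (j : ℕ) < N) (_ : ¬ (i : ℕ) < N),
      D v i j = 0 := by
    intro v i j hj hi
    simp only [D, LinearMap.coe_mk, AddHom.coe_mk, Matrix.of_apply, dif_pos hj, dif_neg hi]
  have hDlast : ∀ v (i : Fin (N + d)) (j : Fin (N + 1)) (_ : ¬ (j : ℕ) < N) (hi : (i : ℕ) < N),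
      D v i j = T v ⟨i, hi⟩ := by
    intro v i j hj hi
    simp only [D, LinearMap.coe_mk, AddHom.coe_mk, Matrix.of_apply, dif_neg hj, dif_pos hi]
  have hDcorner : ∀ v (i : Fin (N + d)) (j : Fin (N + 1)) (_ : ¬ (j : ℕ) < N)
      (_ : ¬ (i : ℕ) < N), D v i j = v (0, ⟨i - N, by omega⟩) := by
    intro v i j hj hi
    simp only [D, LinearMap.coe_mk, AddHom.coe_mk, Matrix.of_apply, dif_neg hj, dif_neg hi]
  let π : (Fin (N + d) → K) →ₗ[K] (Fin N → K) := LinearMap.funLeft K K (Fin.castAdd d)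
  have hπ : ∀ v (j : Fin N), π ((D v).col j.castSucc) = Ev v j := by
    intro v j
    funext i
    exact hDin v (Fin.castAdd d i) j.castSucc j.isLt i.isLt
  have hπl : ∀ v, π ((D v).col (Fin.last N)) = T v := by
    intro v
    funext i
    exact hDlast v (Fin.castAdd d i) (Fin.last N) (by simp) i.isLt
  have hrank : ∀ v ∈ U, v ≠ 0 → d + 1 ≤ (D v).rank := by
    intro v hvU hv
    -- If the first column vanishes, `T v` raises the rank of the first `N` rows to `d + 1`.
    -- Otherwise the first `N` columns have rank at least `d`, and the copy in the bottom rows,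
    -- where they are all zero, makes the last column independent of them.
    by_cases hz : ∀ i, v (0, i) = 0
    · have h := hT v hv hz
      have hle : Submodule.span K (insert (T v) (Set.range (Ev v))) ≤
          (Submodule.span K (Set.range (D v).col)).map π := by
        rw [Submodule.map_span, ← Set.range_comp]
        refine Submodule.span_mono ?_
        rw [Set.insert_subset_iff]
        refine ⟨⟨Fin.last N, hπl v⟩, ?_⟩
        rintro _ ⟨j, rfl⟩
        exact ⟨j.castSucc, hπ v j⟩
      have h3 := (Submodule.finrank_mono hle).trans (Submodule.finrank_map_le _ _)
      rw [← Matrix.rank_eq_finrank_span_cols] at h3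
      omega
    · push Not at hz
      obtain ⟨i, hi⟩ := hz
      have hid : (i : ℕ) < d := by
        by_contra hid
        exact hi ((hU v).1 hvU (0, i) (fun hm => hid (h0 i hm)))
      let X := Submodule.span K (Set.range fun j : Fin N => (D v).col j.castSucc)
      have hX : N ≤ Module.finrank K X + r := by
        have h := hEv v hv Finset.univ
        rw [Finset.card_univ, Fintype.card_fin, Finset.coe_univ, Set.image_univ] at h
        have hle : Submodule.span K (Set.range (Ev v)) ≤ X.map π := by
          rw [Submodule.map_span, ← Set.range_comp]
          refine Submodule.span_mono ?_
          rintro _ ⟨j, rfl⟩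
          exact ⟨j, hπ v j⟩
        have h3 := (Submodule.finrank_mono hle).trans (Submodule.finrank_map_le _ _)
        omega
      have h4 := finrank_add_one_le_sup X ((D v).col (Fin.last N))
        (LinearMap.proj (⟨N + i, by omega⟩ : Fin (N + d))) (by
          have : X ≤ LinearMap.ker (LinearMap.proj (⟨N + i, by omega⟩ : Fin (N + d)) :
              (Fin (N + d) → K) →ₗ[K] K) := by
            rw [Submodule.span_le]
            rintro _ ⟨j, rfl⟩
            exact hDzero v _ j.castSucc j.isLt (by simp)
          exact fun x hx => this hx) (by
          have := hDcorner v ⟨N + i, by omega⟩ (Fin.last N) (by simp) (by simp)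
          simp only [Nat.add_sub_cancel_left] at this
          intro h
          exact hi (this.symm.trans h))
      have h5 := finrank_le_rank (D v) (X ⊔ Submodule.span K {(D v).col (Fin.last N)}) (by
        rw [sup_le_iff]
        constructor
        · refine Submodule.span_mono ?_
          rintro _ ⟨j, rfl⟩
          exact ⟨_, rfl⟩
        · exact Submodule.span_mono (by simp))
      omega
  have hinj : Function.Injective (D ∘ₗ U.subtype) := by
    rw [← LinearMap.ker_eq_bot, LinearMap.ker_eq_bot']
    rintro ⟨v, hv⟩ h
    by_contra hne
    have h1 := hrank v hv (fun h0 => hne (by simpa using h0))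
    have h2 : D v = 0 := h
    rw [h2, Matrix.rank_zero] at h1
    omega
  refine ⟨LinearMap.range (D ∘ₗ U.subtype), isFDRMCode_of_boundCount_lt (i := 0) hF _ ?_ ?_ ?_
    (by omega) ?_⟩
  · rw [LinearMap.finrank_range_of_inj hinj, hUdim, hcard]
  · rintro _ ⟨⟨v, hv⟩, rfl⟩ i j hij
    change D v i j = 0
    by_cases hj : (j : ℕ) < N
    · by_cases hi : (i : ℕ) < N
      · rw [hDin v i j hj hi]
        by_cases hjr : (j : ℕ) < r + 1
        · exact (hsys v ⟨j, hjr⟩ ⟨i, hi⟩).trans ((hU v).1 hv _ hij)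
        · exact absurd (h2 i j hi (by omega) hj) hij
      · exact hDzero v i j hj hi
    · have := hF.last_col (by omega) i i.isLt
      have hjN : (j : ℕ) = N + 1 - 1 := by omega
      rw [← hjN] at this
      exact absurd this hij
  · rintro _ ⟨⟨v, hv⟩, rfl⟩ hne
    refine hrank v hv fun h => hne ?_
    change D v = 0
    rw [h, map_zero]
  -- For distance `d + 2` and `i = 0` the bound discards one more column, `r`, and with it the dot
  -- `(0, r)`.
  · refine Finset.card_lt_card ?_
    rw [Finset.ssubset_iff_of_subset]
    · refine ⟨(0, r), ?_, ?_⟩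
      · exact Finset.mem_filter.2 ⟨hF.first_row (by omega) r (by omega), le_rfl⟩
      · intro h
        have := (Finset.mem_filter.1 h).2.2
        simp only at this
        omega
    · intro c hc
      rw [Finset.mem_filter] at hc ⊢
      exact ⟨hc.1, by omega⟩

/-! ### The code on the proper combination of a rectangle and two lines. -/

theorem card_filter_le_fin (a x : ℕ) :
    (Finset.univ.filter fun i : Fin a => x ≤ (i : ℕ)).card = a - x := by
  rw [← Finset.card_image_of_injective _ Fin.val_injective, ← Nat.card_Ico]
  congr 1
  ext i
  simp only [Finset.mem_image, Finset.mem_filter, Finset.mem_univ, true_and, Finset.mem_Ico]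
  constructor
  · rintro ⟨j, h, rfl⟩
    exact ⟨h, j.isLt⟩
  · rintro ⟨h, h'⟩
    exact ⟨⟨i, h'⟩, h, rfl⟩

/-- The rows of lengths `a` (`d` times), `z` and `c` can be sorted: the rectangle starts at row
`p₁`, the row of length `z` is row `p₂` and the row of length `c` is row `p₃`. -/
theorem exists_row_positions (d a z c : ℕ) :
    ∃ p₁ p₂ p₃ m W : ℕ,
      ((a < c ∧ W = c ∧ p₁ = 1 ∧ p₃ = 0 ∧ p₂ = d + 1) ∨
        (c ≤ a ∧ W = a ∧ z ≤ c ∧ p₁ = 0 ∧ p₃ = d ∧ p₂ = d + 1) ∨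
        (c ≤ a ∧ W = a ∧ c < z ∧ p₁ = 0 ∧ p₂ = d ∧ p₃ = d + 1)) ∧
      ((z = 0 ∧ c = 0 ∧ m = d) ∨ (z = 0 ∧ 0 < c ∧ m = d + 1) ∨ (0 < z ∧ c = 0 ∧ m = d + 1) ∨
        (0 < z ∧ 0 < c ∧ m = d + 2)) := by
  refine ⟨if a < c then 1 else 0, if a < c then d + 1 else if z ≤ c then d + 1 else d,
    if a < c then 0 else if z ≤ c then d else d + 1,
    d + (if z = 0 then 0 else 1) + (if c = 0 then 0 else 1), max a c, ?_, ?_⟩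
  · split_ifs <;> omega
  · split_ifs <;> omega

/-- Both columns are turned into rows, which keeps their dots collinear, and all rows are
right-aligned and sorted by length. The extension has degree `a`, so a row of length `c > a` uses
only its last `a` cells, whence `min c a`. The numbers `e₂`, `e₃` record which information rows are
nonzero: this is the rank that the rectangle alone may lack. -/
theorem exists_code_of_rect_add_lines (K : Type*) [Field K] [Finite K] (d a z c : ℕ) (hd : 1 ≤ d)
    (ha : d + 2 ≤ a) (hz : z ≤ a) :
    ∃ (F : Finset (ℕ × ℕ)) (φ : Fin 3 → ℕ × ℕ → ℕ × ℕ) (m W : ℕ)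
      (C : Submodule K (Matrix (Fin m) (Fin W) K)),
      IsFerrers m W F ∧
      IsProperCombination ![Finset.range d ×ˢ Finset.range a, Finset.range z ×ˢ Finset.range 1,
        Finset.range c ×ˢ Finset.range 1] F φ ∧
      (∀ B ∈ C, ∀ (i : Fin m) (j : Fin W), ((i : ℕ), (j : ℕ)) ∉ F → B i j = 0) ∧
      Module.finrank K C = z + min c a ∧
      ∀ B ∈ C, B ≠ 0 → d + 1 ≤ B.rank ∧
        ∃ e₂ e₃ : ℕ, e₂ ≤ 1 ∧ e₃ ≤ 1 ∧
          d + 1 ≤ (Matrix.of fun (i : Fin d) (j : Fin a) =>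
            entry B (φ 0 ((i : ℕ), (j : ℕ)))).rank + e₂ + e₃ ∧
          (e₂ ≠ 0 → ∃ i < z, entry B (φ 1 (i, 0)) ≠ 0) ∧
          (e₃ ≠ 0 → ∃ i < c, entry B (φ 2 (i, 0)) ≠ 0) := by
  classical
  have hr : 1 + 1 ≤ a := by omega
  obtain ⟨Ev, -, hsys, hEv, -⟩ := exists_gabidulin K a 1 hr
  obtain ⟨p₁, p₂, p₃, m, W, hp, hm⟩ := exists_row_positions d a z c
  let φ : Fin 3 → ℕ × ℕ → ℕ × ℕ :=
    ![fun x => (p₁ + x.1, W - a + x.2), fun x => (p₂, W - z + x.1), fun x => (p₃, W - c + x.1)]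
  let S : Fin 3 → Finset (ℕ × ℕ) := ![Finset.range d ×ˢ Finset.range a,
    Finset.range z ×ˢ Finset.range 1, Finset.range c ×ˢ Finset.range 1]
  let F := (S 0).image (φ 0) ∪ (S 1).image (φ 1) ∪ (S 2).image (φ 2)
  have hm0 : ∀ i j, (i, j) ∈ (S 0).image (φ 0) ↔
      p₁ ≤ i ∧ i < p₁ + d ∧ W - a ≤ j ∧ j < W := by
    intro i j
    simp only [S, φ, Matrix.cons_val_zero, Finset.mem_image, Finset.mem_product, Finset.mem_range,
      Prod.exists, Prod.mk.injEq]
    constructor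
    · rintro ⟨x, y, h, rfl, rfl⟩
      omega
    · intro h
      exact ⟨i - p₁, j - (W - a), by omega, by omega, by omega⟩
  have hm1 : ∀ i j, (i, j) ∈ (S 1).image (φ 1) ↔ i = p₂ ∧ W - z ≤ j ∧ j < W := by
    intro i j
    simp only [S, φ, Matrix.cons_val_one, Matrix.cons_val_zero, Finset.mem_image,
      Finset.mem_product, Finset.mem_range, Prod.exists, Prod.mk.injEq]
    constructor
    · rintro ⟨x, y, h, rfl, rfl⟩
      omega
    · intro h
      exact ⟨j - (W - z), 0, by omega, by omega, by omega⟩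
  have hm2 : ∀ i j, (i, j) ∈ (S 2).image (φ 2) ↔ i = p₃ ∧ W - c ≤ j ∧ j < W := by
    intro i j
    simp only [S, φ, Matrix.cons_val, Finset.mem_image,
      Finset.mem_product, Finset.mem_range, Prod.exists, Prod.mk.injEq]
    constructor
    · rintro ⟨x, y, h, rfl, rfl⟩
      omega
    · intro h
      exact ⟨j - (W - c), 0, by omega, by omega, by omega⟩
  have hmF : ∀ i j, (i, j) ∈ F ↔ (p₁ ≤ i ∧ i < p₁ + d ∧ W - a ≤ j ∧ j < W) ∨
      (i = p₂ ∧ W - z ≤ j ∧ j < W) ∨ (i = p₃ ∧ W - c ≤ j ∧ j < W) := by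
    intro i j
    rw [Finset.mem_union, Finset.mem_union, hm0, hm1, hm2, or_assoc]
  have hFer : IsFerrers m W F := by
    constructor
    · intro i j h
      rw [hmF] at h
      omega
    · intro i j h
      rw [hmF] at h ⊢
      omega
    · intro i j h _
      rw [hmF] at h ⊢
      omega
    · intro _ j _
      rw [hmF]
      omega
    · intro _ i _
      rw [hmF]
      omega
  have hd01 : Disjoint ((S 0).image (φ 0)) ((S 1).image (φ 1)) := by
    rw [Finset.disjoint_left]
    rintro ⟨i, j⟩ h h'
    rw [hm0] at h
    rw [hm1] at h'
    omega
  have hd02 : Disjoint ((S 0).image (φ 0)) ((S 2).image (φ 2)) := by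
    rw [Finset.disjoint_left]
    rintro ⟨i, j⟩ h h'
    rw [hm0] at h
    rw [hm2] at h'
    omega
  have hd12 : Disjoint ((S 1).image (φ 1)) ((S 2).image (φ 2)) := by
    rw [Finset.disjoint_left]
    rintro ⟨i, j⟩ h h'
    rw [hm1] at h
    rw [hm2] at h'
    omega
  have hinj : ∀ l, Set.InjOn (φ l) (S l : Set (ℕ × ℕ)) := by
    intro l
    fin_cases l <;> rintro ⟨x, y⟩ hx ⟨x', y'⟩ hx' h <;> simp [S, φ] at hx hx' h ⊢ <;> omega
  have hcomb : IsProperCombination S F φ := by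
    refine ⟨?_, hinj, ?_, ?_, ?_⟩
    · intro l x hx
      have := Finset.mem_image_of_mem (φ l) hx
      fin_cases l
      · exact Finset.mem_union_left _ (Finset.mem_union_left _ this)
      · exact Finset.mem_union_left _ (Finset.mem_union_right _ this)
      · exact Finset.mem_union_right _ this
    · intro l l' hne
      fin_cases l <;> fin_cases l'
      · exact absurd rfl hne
      · exact hd01
      · exact hd02
      · exact hd01.symm
      · exact absurd rfl hne
      · exact hd12
      · exact hd02.symm
      · exact hd12.symm
      · exact absurd rfl hne
    · rw [Finset.card_union_of_disjoint (Finset.disjoint_union_left.2 ⟨hd02, hd12⟩),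
        Finset.card_union_of_disjoint hd01, Finset.card_image_of_injOn (hinj 0),
        Finset.card_image_of_injOn (hinj 1), Finset.card_image_of_injOn (hinj 2),
        Fin.sum_univ_three]
    · intro l x hx y hy _ h
      fin_cases l
      · simp only [φ, Fin.zero_eta, Matrix.cons_val_zero]
        omega
      · exact Or.inl rfl
      · exact Or.inl rfl
  -- Information is confined to the last `z`, respectively `min c a`, coordinates; truncated
  -- subtraction removes the restriction on the second row when `c ≥ a`.
  obtain ⟨U, hUdim, hU⟩ := exists_finrank_eq_card (K := K)
    (Finset.univ.filter fun p : Fin 2 × Fin a => a - (if p.1 = 0 then z else c) ≤ (p.2 : ℕ))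
  have hcard : (Finset.univ.filter fun p : Fin 2 × Fin a =>
      a - (if p.1 = 0 then z else c) ≤ (p.2 : ℕ)).card = z + min c a := by
    rw [Finset.card_filter, Fintype.sum_prod_type, Fin.sum_univ_two]
    simp only [← Finset.card_filter, card_filter_le_fin, if_true, one_ne_zero, if_false]
    omega
  have hU0 : ∀ v ∈ U, ∀ i : Fin a, (i : ℕ) < a - z → v (0, i) = 0 := by
    intro v hv i hi
    refine (hU v).1 hv _ ?_
    simpa using (by omega : (i : ℕ) + z < a)
  have hU1 : ∀ v ∈ U, ∀ i : Fin a, (i : ℕ) < a - c → v (1, i) = 0 := by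
    intro v hv i hi
    refine (hU v).1 hv _ ?_
    simpa using (by omega : (i : ℕ) + c < a)
  -- The values at points `0` and `1` go to rows `p₂` and `p₃`; the shift by `2` puts the following
  -- `d` values in the rectangle.
  let D : (Fin 2 × Fin a → K) →ₗ[K] Matrix (Fin m) (Fin W) K :=
    { toFun := fun v => Matrix.of fun i j =>
        if hj : W - a ≤ (j : ℕ) then
          if hi : p₁ ≤ (i : ℕ) ∧ (i : ℕ) < p₁ + d then
            Ev v ⟨i - p₁ + 2, by omega⟩ ⟨j - (W - a), by omega⟩
          else if (i : ℕ) = p₂ then v (0, ⟨j - (W - a), by omega⟩)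
          else if (i : ℕ) = p₃ then v (1, ⟨j - (W - a), by omega⟩) else 0
        else 0
      map_add' := fun v w => by
        ext i j
        simp only [map_add, Matrix.of_apply, Matrix.add_apply, Pi.add_apply]
        split_ifs <;> simp
      map_smul' := fun b v => by
        ext i j
        simp only [map_smul, Matrix.of_apply, Matrix.smul_apply, Pi.smul_apply, RingHom.id_apply]
        split_ifs <;> simp }
  have hD : ∀ v i j, D v i j = if hj : W - a ≤ (j : ℕ) then
          if hi : p₁ ≤ (i : ℕ) ∧ (i : ℕ) < p₁ + d then
            Ev v ⟨i - p₁ + 2, by omega⟩ ⟨j - (W - a), by omega⟩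
          else if (i : ℕ) = p₂ then v (0, ⟨j - (W - a), by omega⟩)
          else if (i : ℕ) = p₃ then v (1, ⟨j - (W - a), by omega⟩) else 0
        else 0 := fun _ _ _ => rfl
  have hD1 : ∀ v (i : Fin d) (j : Fin a), D v ⟨p₁ + i, by omega⟩ ⟨W - a + j, by omega⟩ =
      Ev v ⟨i + 2, by omega⟩ j := by
    intro v i j
    rw [hD, dif_pos (by simp), dif_pos (by simp)]
    simp only [Nat.add_sub_cancel_left]
  have hD2 : ∀ v (_ : 0 < z) (j : Fin a), D v ⟨p₂, by omega⟩ ⟨W - a + j, by omega⟩ = v (0, j) := by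
    intro v _ j
    rw [hD, dif_pos (by simp), dif_neg (by simp only; omega), if_pos rfl]
    simp only [Nat.add_sub_cancel_left]
  have hD3 : ∀ v (_ : 0 < c) (j : Fin a), D v ⟨p₃, by omega⟩ ⟨W - a + j, by omega⟩ = v (1, j) := by
    intro v _ j
    rw [hD, dif_pos (by simp), dif_neg (by simp only; omega), if_neg (by simp only; omega),
      if_pos rfl]
    simp only [Nat.add_sub_cancel_left]
  have hE0 : ∀ v, Ev v ⟨0, by omega⟩ = fun i => v (0, i) := fun v => funext fun i => hsys v 0 i
  have hE1 : ∀ v, Ev v ⟨1, by omega⟩ = fun i => v (1, i) := fun v => funext fun i => hsys v 1 i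
  -- The first `d + 2` points suffice, and `d + 2 ≤ a` guarantees that they exist.
  have hspan : ∀ v, v ≠ 0 → ∀ X : Submodule K (Fin a → K),
      (∀ k : Fin a, (k : ℕ) < d + 2 → Ev v k ∈ X) → d + 1 ≤ Module.finrank K X := by
    intro v hv X hX
    have h := hEv v hv (Finset.univ.image (Fin.castLE ha))
    rw [Finset.card_image_of_injective _ (Fin.castLE_injective ha), Finset.card_univ,
      Fintype.card_fin] at h
    have hle : Submodule.span K (Ev v '' (Finset.univ.image (Fin.castLE ha))) ≤ X := by
      rw [Submodule.span_le]
      rintro _ ⟨k, hk, rfl⟩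
      simp only [Finset.coe_image, Finset.coe_univ, Set.image_univ, Set.mem_range] at hk
      obtain ⟨k, rfl⟩ := hk
      exact hX _ k.isLt
    have := Submodule.finrank_mono hle
    omega
  have hsplit : ∀ v (X : Submodule K (Fin a → K)), (fun i => v (0, i)) ∈ X →
      (fun i => v (1, i)) ∈ X → (∀ i : Fin d, Ev v ⟨i + 2, by omega⟩ ∈ X) →
      ∀ k : Fin a, (k : ℕ) < d + 2 → Ev v k ∈ X := by
    rintro v X h0 h1 h2 ⟨k, hk⟩ hkd
    match k, hk, hkd with
    | 0, hk, _ => exact hE0 v ▸ h0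
    | 1, hk, _ => exact hE1 v ▸ h1
    | k + 2, hk, hkd => exact h2 ⟨k, by simp only at hkd; omega⟩
  have hrank : ∀ v ∈ U, v ≠ 0 → d + 1 ≤ (D v).rank := by
    intro v hvU hv
    -- Projecting to the last `a` columns recovers all `d + 2` values from the rows. A line of
    -- length `0` has no row, but then its value is zero.
    let ρ : (Fin W → K) →ₗ[K] (Fin a → K) :=
      LinearMap.funLeft K K (fun j : Fin a => (⟨W - a + j, by omega⟩ : Fin W))
    have hρ : ∀ i : Fin m, ρ ((D v).row i) ∈
        (Submodule.span K (Set.range (D v).row)).map ρ := fun i =>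
      Submodule.mem_map_of_mem (Submodule.subset_span ⟨i, rfl⟩)
    have h := hspan v hv ((Submodule.span K (Set.range (D v).row)).map ρ) (hsplit v _ ?_ ?_ ?_)
    · refine h.trans ((Submodule.finrank_map_le _ _).trans ?_)
      rw [Matrix.rank_eq_finrank_span_row]
    · rcases Nat.eq_zero_or_pos z with h0 | h0
      · rw [show (fun i => v (0, i)) = 0 from funext fun i => hU0 v hvU i (by omega)]
        exact Submodule.zero_mem _
      · rw [show (fun i => v (0, i)) = ρ ((D v).row ⟨p₂, by omega⟩) from
          funext fun i => (hD2 v h0 i).symm]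
        exact hρ _
    · rcases Nat.eq_zero_or_pos c with h0 | h0
      · rw [show (fun i => v (1, i)) = 0 from funext fun i => hU1 v hvU i (by omega)]
        exact Submodule.zero_mem _
      · rw [show (fun i => v (1, i)) = ρ ((D v).row ⟨p₃, by omega⟩) from
          funext fun i => (hD3 v h0 i).symm]
        exact hρ _
    · intro i
      rw [show Ev v ⟨i + 2, by omega⟩ = ρ ((D v).row ⟨p₁ + i, by omega⟩) from
          funext fun j => (hD1 v i j).symm]
      exact hρ _
  have hDinj : Function.Injective (D ∘ₗ U.subtype) := by
    rw [← LinearMap.ker_eq_bot, LinearMap.ker_eq_bot']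
    rintro ⟨v, hv⟩ h
    by_contra hne
    have h1 := hrank v hv (fun h0 => hne (by simpa using h0))
    have h2 : D v = 0 := h
    rw [h2, Matrix.rank_zero] at h1
    omega
  refine ⟨F, φ, m, W, LinearMap.range (D ∘ₗ U.subtype), hFer, hcomb, ?_, ?_, ?_⟩
  · rintro _ ⟨⟨v, hv⟩, rfl⟩ i j hij
    change D v i j = 0
    rw [hmF] at hij
    rw [hD]
    split_ifs with hj hi h2 h3
    · omega
    · exact hU0 v hv _ (by simp only; omega)
    · exact hU1 v hv _ (by simp only; omega)
    · rfl
    · rfl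
  · rw [LinearMap.finrank_range_of_inj hDinj, hUdim, hcard]
  · rintro _ ⟨⟨v, hvU⟩, rfl⟩ hne
    have hv : v ≠ 0 := by
      rintro rfl
      exact hne (map_zero D)
    refine ⟨hrank v hvU hv, if (fun i => v (0, i)) = 0 then 0 else 1,
      if (fun i => v (1, i)) = 0 then 0 else 1, by split_ifs <;> omega, by split_ifs <;> omega,
      ?_, ?_, ?_⟩
    · set A := Matrix.of fun (i : Fin d) (j : Fin a) =>
        entry ((D ∘ₗ U.subtype) ⟨v, hvU⟩) (φ 0 ((i : ℕ), (j : ℕ))) with hA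
      have hArow : ∀ i : Fin d, A.row i = Ev v ⟨i + 2, by omega⟩ := by
        intro i
        funext j
        rw [← hD1]
        exact entry_fin (D v) ⟨p₁ + i, by omega⟩ ⟨W - a + j, by omega⟩
      have h := hspan v hv (Submodule.span K (Set.range A.row) ⊔
        Submodule.span K {fun i => v (0, i)} ⊔ Submodule.span K {fun i => v (1, i)})
        (hsplit v _ ?_ ?_ ?_)
      · refine h.trans ((finrank_sup_span_singleton_le _ _).trans ?_)
        refine Nat.add_le_add_right ((finrank_sup_span_singleton_le _ _).trans ?_) _
        rw [Matrix.rank_eq_finrank_span_row]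
      · exact Submodule.mem_sup_left (Submodule.mem_sup_right
          (Submodule.mem_span_singleton_self _))
      · exact Submodule.mem_sup_right (Submodule.mem_span_singleton_self _)
      · intro i
        rw [← hArow]
        exact Submodule.mem_sup_left (Submodule.mem_sup_left (Submodule.subset_span ⟨i, rfl⟩))
    · intro h
      by_contra! hcon
      refine h (if_pos (funext fun i => ?_))
      by_cases hi : (i : ℕ) < a - z
      · exact hU0 v hvU i hi
      · have h0 : 0 < z := by omega
        have h1 := hcon (i - (a - z)) (by omega)
        rw [Pi.zero_apply, ← h1, ← hD2 v h0 i, ← entry_fin (D v)]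
        change entry (D v) _ = entry (D v) (p₂, W - z + (i - (a - z)))
        congr 2
        simp only
        omega
    · intro h
      by_contra! hcon
      refine h (if_pos (funext fun i => ?_))
      by_cases hi : (i : ℕ) < a - c
      · exact hU1 v hvU i hi
      · have h0 : 0 < c := by omega
        have h1 := hcon (W - a + i - (W - c)) (by omega)
        rw [Pi.zero_apply, ← h1, ← hD3 v h0 i, ← entry_fin (D v)]
        change entry (D v) _ = entry (D v) (p₃, W - c + (W - a + i - (W - c)))
        congr 2
        simp only
        omega

/-! ### Special diagrams and their decomposition into four parts. -/

theorem entry_of_lt {K : Type*} [Field K] {m n : ℕ} (A : Matrix (Fin m) (Fin n) K) (i j : ℕ)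
    (hi : i < m) (hj : j < n) : entry A (i, j) = A ⟨i, hi⟩ ⟨j, hj⟩ := by
  simp [entry, hi, hj]

theorem entry_of_not_lt {K : Type*} [Field K] {m n : ℕ} (A : Matrix (Fin m) (Fin n) K) (i j : ℕ)
    (h : ¬ (i < m ∧ j < n)) : entry A (i, j) = 0 := by
  unfold entry
  rw [dif_neg h]

theorem entry_zero {K : Type*} [Field K] {m n : ℕ} (x : ℕ × ℕ) :
    entry (0 : Matrix (Fin m) (Fin n) K) x = 0 :=
  map_zero (entryHom K m n x)

theorem entry_eq_zero_of_support {K : Type*} [Field K] {m n : ℕ} {F : Finset (ℕ × ℕ)}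
    {A : Matrix (Fin m) (Fin n) K}
    (hA : ∀ (i : Fin m) (j : Fin n), ((i : ℕ), (j : ℕ)) ∉ F → A i j = 0) (x : ℕ × ℕ)
    (hx : x ∉ F) : entry A x = 0 := by
  unfold entry
  split_ifs with h
  · exact hA _ _ hx
  · rfl

theorem entry_injective {K : Type*} [Field K] {m n : ℕ} {A B : Matrix (Fin m) (Fin n) K}
    (h : ∀ x, entry A x = entry B x) : A = B := by
  ext i j
  exact (entry_fin A i j).symm.trans ((h _).trans (entry_fin B i j))

theorem isFerrers_rect {m n : ℕ} : IsFerrers m n (Finset.range m ×ˢ Finset.range n) := by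
  constructor <;> simp only [Finset.mem_product, Finset.mem_range] <;> omega

/-- The diagram `F` of shape `(N + d + c) × (a + N + 1)`: `d` full rows, then rows whose first `a`
cells are empty and whose last `d` cells are full, then, from row `N` on, rows with a single dot;
its column `a` has `d + z` dots. -/
structure IsSpecial (d N a c z : ℕ) (F : Finset (ℕ × ℕ)) : Prop where
  pos : 1 ≤ d
  le : d ≤ N
  wide : d + 2 ≤ a
  z_le : z ≤ a
  z_le' : z ≤ N - d
  ferrers : IsFerrers (N + d + c) (a + N + 1) F
  top : ∀ i j, i < d → j < a + N + 1 → (i, j) ∈ F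
  middle_left : ∀ i j, d ≤ i → i < N → j < a → (i, j) ∉ F
  middle_right : ∀ i j, d ≤ i → i < N → a + N + 1 - d ≤ j → j < a + N + 1 → (i, j) ∈ F
  bottom : ∀ i j, N ≤ i → i < N + d + c → ((i, j) ∈ F ↔ j = a + N)
  col : ∀ i, d ≤ i → ((i, a) ∈ F ↔ i < d + z)

/-- The top right part of a special diagram, without its column below the first `d` rows. -/
def cornerPart (d N a : ℕ) (F : Finset (ℕ × ℕ)) : Finset (ℕ × ℕ) :=
  (Finset.range (N + d) ×ˢ Finset.range (N + 1)).filter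
    fun x => (x.1, x.2 + a) ∈ F ∧ (x.2 = 0 → x.1 < d)

theorem mem_cornerPart {d N a i j : ℕ} {F : Finset (ℕ × ℕ)} :
    (i, j) ∈ cornerPart d N a F ↔
      i < N + d ∧ j < N + 1 ∧ (i, j + a) ∈ F ∧ (j = 0 → i < d) := by
  simp [cornerPart, and_assoc]

namespace IsSpecial
variable {d N a c z : ℕ} {F : Finset (ℕ × ℕ)}

theorem last_col (h : IsSpecial d N a c z F) (i : ℕ) (hi : i < N + d + c) : (i, a + N) ∈ F := by
  have := h.ferrers.last_col (by omega) i hi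
  simpa using this

theorem isFerrers_cornerPart (h : IsSpecial d N a c z F) :
    IsFerrers (N + d) (N + 1) (cornerPart d N a F) := by
  have h1 := h.pos
  have h2 := h.le
  constructor
  · intro i j hm
    rw [mem_cornerPart] at hm
    omega
  · intro i j hm
    rw [mem_cornerPart] at hm ⊢
    exact ⟨by omega, by omega, h.ferrers.up _ _ hm.2.2.1, by omega⟩
  · intro i j hm hj
    rw [mem_cornerPart] at hm ⊢
    refine ⟨by omega, by omega, ?_, by omega⟩
    have := h.ferrers.right _ _ hm.2.2.1 (by omega)
    rwa [show j + 1 + a = j + a + 1 by omega]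
  · intro _ j hj
    rw [mem_cornerPart]
    exact ⟨by omega, by omega, h.top _ _ (by omega) (by omega), by omega⟩
  · intro _ i hi
    rw [mem_cornerPart]
    refine ⟨by omega, by omega, ?_, by omega⟩
    rw [show N + 1 - 1 + a = a + N by omega]
    exact h.last_col i (by omega)

theorem isDecomposition (h : IsSpecial d N a c z F) :
    IsDecomposition (N + d + c) (a + N + 1) F (Finset.range d ×ˢ Finset.range a)
      (Finset.range z ×ˢ Finset.range 1) (Finset.range c ×ˢ Finset.range 1) (cornerPart d N a F)
      d a z 1 c 1 (N + d) (N + 1) := by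
  have h1 := h.pos
  have h2 := h.le
  have h3 := h.z_le'
  have hs2 : ∀ i j, (i, j) ∈ shift d a (Finset.range z ×ˢ Finset.range 1) ↔
      d ≤ i ∧ i < d + z ∧ j = a := by
    intro i j
    simp only [shift, Finset.mem_image, Finset.mem_product, Finset.mem_range, Prod.exists,
      Prod.mk.injEq]
    constructor
    · rintro ⟨x, y, h, rfl, rfl⟩
      omega
    · intro h
      exact ⟨i - d, 0, by omega, by omega, by omega⟩
  have hs3 : ∀ i j, (i, j) ∈ shift (N + d) (a + N + 1 - 1) (Finset.range c ×ˢ Finset.range 1) ↔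
      N + d ≤ i ∧ i < N + d + c ∧ j = a + N := by
    intro i j
    simp only [shift, Finset.mem_image, Finset.mem_product, Finset.mem_range, Prod.exists,
      Prod.mk.injEq]
    constructor
    · rintro ⟨x, y, h, rfl, rfl⟩
      omega
    · intro h
      exact ⟨i - (N + d), 0, by omega, by omega, by omega⟩
  have hs4 : ∀ i j, (i, j) ∈ shift 0 a (cornerPart d N a F) ↔
      i < N + d ∧ a ≤ j ∧ j < a + N + 1 ∧ (i, j) ∈ F ∧ (j = a → i < d) := by
    intro i j
    simp only [shift, Finset.mem_image, Prod.exists, Prod.mk.injEq, mem_cornerPart]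
    constructor
    · rintro ⟨x, y, h, rfl, rfl⟩
      exact ⟨by omega, by omega, by omega, h.2.2.1, by omega⟩
    · intro h
      refine ⟨i, j - a, ⟨by omega, by omega, ?_, by omega⟩, by omega, by omega⟩
      rw [Nat.sub_add_cancel h.2.1]
      exact h.2.2.2.1
  refine ⟨h.ferrers, isFerrers_rect, isFerrers_rect, isFerrers_rect, h.isFerrers_cornerPart,
    by omega, by omega, by omega, by omega, ?_, ?_⟩
  · ext ⟨i, j⟩
    simp only [Finset.mem_union, hs2, hs3, hs4, Finset.mem_product, Finset.mem_range]
    constructor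
    · intro hm
      have hb := h.ferrers.bounds _ _ hm
      by_cases hja : j < a
      · by_cases hid : i < d
        · exact Or.inl (Or.inl (Or.inl ⟨hid, hja⟩))
        · by_cases hiN : i < N
          · exact absurd hm (h.middle_left i j (by omega) hiN hja)
          · have := (h.bottom i j (by omega) (by omega)).1 hm
            omega
      · by_cases hiN : i < N + d
        · by_cases hj : j = a ∧ d ≤ i
          · obtain ⟨rfl, hdi⟩ := hj
            exact Or.inl (Or.inl (Or.inr ⟨hdi, (h.col i hdi).1 hm, rfl⟩))
          · exact Or.inr ⟨hiN, by omega, by omega, hm, by omega⟩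
        · have := (h.bottom i j (by omega) (by omega)).1 hm
          exact Or.inl (Or.inr ⟨by omega, by omega, this⟩)
    · rintro (((hm | ⟨hdi, hi, rfl⟩) | ⟨_, hi, rfl⟩) | hm)
      · exact h.top i j hm.1 (by omega)
      · exact (h.col i hdi).2 hi
      · exact h.last_col i hi
      · exact hm.2.2.2.1
  · rw [Finset.disjoint_left]
    rintro ⟨i, j⟩ hm hm'
    rw [hs2] at hm
    rw [hs4] at hm'
    omega

end IsSpecial

/-! ### Gluing the two codes. -/

/-- The matrix glued from `B` and `D`, as a linear function of the pair. -/
noncomputable def glue (K : Type*) [Field K] (d N a c z m' W : ℕ) (φ : Fin 3 → ℕ × ℕ → ℕ × ℕ) :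
    (Matrix (Fin m') (Fin W) K × Matrix (Fin (N + d)) (Fin (N + 1)) K) →ₗ[K]
      Matrix (Fin (N + d + c)) (Fin (a + N + 1)) K where
  toFun p := Matrix.of fun i j =>
    if (i : ℕ) < d ∧ (j : ℕ) < a then entryHom K m' W (φ 0 (i, j)) p.1
    else if (j : ℕ) = a ∧ d ≤ (i : ℕ) then
      if (i : ℕ) < d + z then entryHom K m' W (φ 1 (i - d, 0)) p.1 else 0
    else if (j : ℕ) = a + N ∧ N + d ≤ (i : ℕ) then entryHom K m' W (φ 2 (i - (N + d), 0)) p.1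
    else if a ≤ (j : ℕ) then entryHom K (N + d) (N + 1) (i, j - a) p.2 else 0
  map_add' p p' := by
    ext i j
    simp only [Prod.fst_add, Prod.snd_add, map_add, Matrix.of_apply, Matrix.add_apply]
    split_ifs <;> simp
  map_smul' b p := by
    ext i j
    simp only [Prod.smul_fst, Prod.smul_snd, map_smul, Matrix.of_apply, Matrix.smul_apply,
      RingHom.id_apply]
    split_ifs <;> simp

section glue
variable {K : Type*} [Field K] {d N a c z m' W : ℕ} {φ : Fin 3 → ℕ × ℕ → ℕ × ℕ}
  (B : Matrix (Fin m') (Fin W) K) (D : Matrix (Fin (N + d)) (Fin (N + 1)) K)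

theorem glue_apply (i : Fin (N + d + c)) (j : Fin (a + N + 1)) :
    glue K d N a c z m' W φ (B, D) i j =
    if (i : ℕ) < d ∧ (j : ℕ) < a then entry B (φ 0 (i, j))
    else if (j : ℕ) = a ∧ d ≤ (i : ℕ) then
      if (i : ℕ) < d + z then entry B (φ 1 (i - d, 0)) else 0
    else if (j : ℕ) = a + N ∧ N + d ≤ (i : ℕ) then entry B (φ 2 (i - (N + d), 0))
    else if a ≤ (j : ℕ) then entry D (i, j - a) else 0 := rfl

theorem isGluing_glue {F : Finset (ℕ × ℕ)} (h : IsSpecial d N a c z F)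
    (hD : ∀ (i : Fin (N + d)) (j : Fin (N + 1)), ((i : ℕ), (j : ℕ)) ∉ cornerPart d N a F →
      D i j = 0) :
    IsGluing F (Finset.range d ×ˢ Finset.range a)
      (Finset.range z ×ˢ Finset.range 1) (Finset.range c ×ˢ Finset.range 1) (cornerPart d N a F)
      d a 1 φ (glue K d N a c z m' W φ (B, D)) B D := by
  have h1 := h.pos
  have h2 := h.le
  have h3 := h.z_le'
  constructor
  · rintro ⟨i, j⟩ hx
    simp only [Finset.mem_product, Finset.mem_range] at hx
    rw [entry_of_lt _ _ _ (by omega) (by omega), glue_apply, if_pos hx]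
  · rintro ⟨i, j⟩ hx
    simp only [Finset.mem_product, Finset.mem_range] at hx
    obtain rfl : j = 0 := by omega
    rw [entry_of_lt _ _ _ (by simp only; omega) (by simp only; omega), glue_apply,
      if_neg (by simp only; omega), if_pos (by simp only; omega), if_pos (by simp only; omega)]
    simp only [Nat.add_sub_cancel]
  · rintro ⟨i, j⟩ hx
    simp only [Finset.mem_product, Finset.mem_range] at hx
    obtain rfl : j = 0 := by omega
    rw [entry_of_lt _ _ _ (by simp only; omega) (by simp only; omega), glue_apply,
      if_neg (by simp only; omega), if_neg (by simp only; omega), if_pos (by simp only; omega)]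
    simp only [Nat.add_sub_cancel]
  · rintro ⟨i, j⟩ hx
    rw [mem_cornerPart] at hx
    rw [entry_of_lt _ _ _ (by simp only; omega) (by simp only; omega), glue_apply,
      if_neg (by simp only; omega), if_neg (by simp only; omega), if_neg (by simp only; omega),
      if_pos (by simp only; omega)]
    simp only [Nat.add_sub_cancel]
  · rintro ⟨i, j⟩ hx
    by_cases hb : i < N + d + c ∧ j < a + N + 1
    · rw [entry_of_lt _ _ _ hb.1 hb.2, glue_apply]
      simp only
      split_ifs with g1 g2 g3 g4 g5
      · exact absurd (h.top i j g1.1 hb.2) hx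
      · obtain ⟨rfl, hdi⟩ := g2
        exact absurd ((h.col i hdi).2 g3) hx
      · rfl
      · rw [g4.1] at hx
        exact absurd (h.last_col i hb.1) hx
      · refine entry_eq_zero_of_support hD _ fun hm => hx ?_
        rw [mem_cornerPart, Nat.sub_add_cancel g5] at hm
        exact hm.2.2.1
      · rfl
    · exact entry_of_not_lt _ _ _ hb

/-- With `B = 0` the matrix `D` is the top right block: the cells of `F₂` overlap this block, but
`D` is zero on them since they are excluded from `cornerPart`. -/
theorem rank_le_rank_glue_zero {F : Finset (ℕ × ℕ)} (h : IsSpecial d N a c z F)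
    (hD : ∀ (i : Fin (N + d)) (j : Fin (N + 1)), ((i : ℕ), (j : ℕ)) ∉ cornerPart d N a F →
      D i j = 0) :
    D.rank ≤ (glue K d N a c z m' W φ (0, D)).rank := by
  have h1 := h.pos
  have h2 := h.le
  have hsub : D = (glue K d N a c z m' W φ (0, D)).submatrix
      (fun i : Fin (N + d) => ⟨i, by omega⟩) (fun j : Fin (N + 1) => ⟨a + j, by omega⟩) := by
    ext i j
    rw [Matrix.submatrix_apply, glue_apply]
    simp only [entry_zero, ite_self, Nat.add_sub_cancel_left]
    rw [if_neg (by omega)]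
    split_ifs with g1 g2 g3
    · refine hD i j fun hm => ?_
      rw [mem_cornerPart] at hm
      omega
    · omega
    · exact (entry_fin D i j).symm
    · omega
  calc D.rank = _ := congrArg Matrix.rank hsub
    _ ≤ _ := Matrix.rank_submatrix_le _ _ _

/-- A staircase argument independent of `D`: the first `a` columns vanish from row `d` on, column
`a` carries `F₂` there and vanishes from row `d + z ≤ N` on, and the last column carries `F₃` from
row `N + d` on. -/
theorem rank_add_le_rank_glue {F : Finset (ℕ × ℕ)} (h : IsSpecial d N a c z F) (e₂ e₃ : ℕ)
    (h₂ : e₂ ≤ 1) (h₃ : e₃ ≤ 1) (hB₂ : e₂ ≠ 0 → ∃ i < z, entry B (φ 1 (i, 0)) ≠ 0)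
    (hB₃ : e₃ ≠ 0 → ∃ i < c, entry B (φ 2 (i, 0)) ≠ 0) :
    (Matrix.of fun (i : Fin d) (j : Fin a) => entry B (φ 0 ((i : ℕ), (j : ℕ)))).rank + e₂ + e₃ ≤
      (glue K d N a c z m' W φ (B, D)).rank := by
  have hd := h.pos
  have hdN := h.le
  have hz := h.z_le'
  set A := glue K d N a c z m' W φ (B, D) with hA
  set R := LinearMap.range A.mulVecLin with hR
  have hcol : ∀ j, A.col j ∈ R := fun j => by
    rw [hR, Matrix.range_mulVecLin]
    exact Submodule.subset_span ⟨j, rfl⟩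
  let X := Submodule.span K (Set.range fun j : Fin a => A.col ⟨j, by omega⟩)
  have hXR : X ≤ R := by
    rw [Submodule.span_le]
    rintro _ ⟨j, rfl⟩
    exact hcol _
  have hX0 : ∀ x ∈ X, ∀ i : Fin (N + d + c), d ≤ (i : ℕ) → x i = 0 := by
    intro x hx i hi
    have : X ≤ LinearMap.ker (LinearMap.proj i : (Fin (N + d + c) → K) →ₗ[K] K) := by
      rw [Submodule.span_le]
      rintro _ ⟨j, rfl⟩
      change A i ⟨j, _⟩ = 0
      rw [hA, glue_apply, if_neg (by simp only; omega), if_neg (by simp only; omega),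
        if_neg (by simp only; omega), if_neg (by simp only; omega)]
    exact this hx
  have hXrank : (Matrix.of fun (i : Fin d) (j : Fin a) =>
      entry B (φ 0 ((i : ℕ), (j : ℕ)))).rank ≤ Module.finrank K X := by
    let π : (Fin (N + d + c) → K) →ₗ[K] (Fin d → K) :=
      LinearMap.funLeft K K (fun i : Fin d => (⟨i, by omega⟩ : Fin (N + d + c)))
    refine le_trans ?_ (Submodule.finrank_map_le π X)
    refine rank_le_finrank _ _ ?_
    rintro j
    refine Submodule.mem_map.2 ⟨A.col ⟨j, by omega⟩, Submodule.subset_span ⟨j, rfl⟩, ?_⟩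
    funext i
    change A ⟨i, _⟩ ⟨j, _⟩ = _
    rw [hA, glue_apply, if_pos ⟨i.isLt, j.isLt⟩]
    rfl
  -- `Y` adjoins column `a` only when `F₂` is known to be nonzero; either way it stays zero in the
  -- rows of `F₃`.
  obtain ⟨Y, hYR, hYrank, hY0⟩ : ∃ Y ≤ R, Module.finrank K X + e₂ ≤ Module.finrank K Y ∧
      ∀ x ∈ Y, ∀ i : Fin (N + d + c), N + d ≤ (i : ℕ) → x i = 0 := by
    by_cases he : e₂ = 0
    · exact ⟨X, hXR, by omega, fun x hx i hi => hX0 x hx i (by omega)⟩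
    · obtain ⟨i₀, hi₀, hne⟩ := hB₂ he
      refine ⟨X ⊔ Submodule.span K {A.col ⟨a, by omega⟩}, ?_, ?_, ?_⟩
      · rw [sup_le_iff, Submodule.span_singleton_le_iff_mem]
        exact ⟨hXR, hcol _⟩
      · refine le_trans (Nat.add_le_add_left h₂ _) (finrank_add_one_le_sup X _
          (LinearMap.proj (⟨d + i₀, by omega⟩ : Fin (N + d + c)))
          (fun x hx => hX0 x hx _ (by simp)) ?_)
        change A ⟨d + i₀, _⟩ ⟨a, _⟩ ≠ 0
        rw [hA, glue_apply, if_neg (by simp only; omega), if_pos ⟨rfl, by simp only; omega⟩,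
          if_pos (by simp only; omega)]
        simpa using hne
      · intro x hx i hi
        obtain ⟨y, hy, w, hw, rfl⟩ := Submodule.mem_sup.1 hx
        obtain ⟨b, rfl⟩ := Submodule.mem_span_singleton.1 hw
        have : A i ⟨a, by omega⟩ = 0 := by
          rw [hA, glue_apply, if_neg (by simp only; omega), if_pos ⟨rfl, by omega⟩,
            if_neg (by omega)]
        simp only [Pi.add_apply, Pi.smul_apply, Matrix.col, Matrix.transpose_apply, this,
          smul_zero, add_zero]
        exact hX0 y hy i (by omega)
  have hfin : Module.finrank K Y + e₃ ≤ A.rank := by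
    by_cases he : e₃ = 0
    · rw [he]
      exact Submodule.finrank_mono hYR
    · obtain ⟨i₀, hi₀, hne⟩ := hB₃ he
      refine le_trans (Nat.add_le_add_left h₃ _) ((finrank_add_one_le_sup Y
        (A.col ⟨a + N, by omega⟩) (LinearMap.proj (⟨N + d + i₀, by omega⟩ : Fin (N + d + c)))
        (fun x hx => hY0 x hx _ (by simp)) ?_).trans (Submodule.finrank_mono ?_))
      · change A ⟨N + d + i₀, _⟩ ⟨a + N, _⟩ ≠ 0
        rw [hA, glue_apply, if_neg (by simp only; omega), if_neg (by simp only; omega),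
          if_pos ⟨rfl, by simp only; omega⟩]
        simpa using hne
      · rw [sup_le_iff, Submodule.span_singleton_le_iff_mem]
        exact ⟨hYR, hcol _⟩
  omega

theorem IsGluing.unique {m n m₄ n₄ m₁ n₁ m₂ n₂ m₃ n₃ : ℕ} {F F₁ F₂ F₃ F₄ : Finset (ℕ × ℕ)}
    (hd : IsDecomposition m n F F₁ F₂ F₃ F₄ m₁ n₁ m₂ n₂ m₃ n₃ m₄ n₄)
    {A A' : Matrix (Fin m) (Fin n) K} {B : Matrix (Fin m') (Fin W) K}
    {D : Matrix (Fin m₄) (Fin n₄) K} (h : IsGluing F F₁ F₂ F₃ F₄ m₁ n₁ n₃ φ A B D)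
    (h' : IsGluing F F₁ F₂ F₃ F₄ m₁ n₁ n₃ φ A' B D) : A = A' := by
  refine entry_injective fun x => ?_
  by_cases hx : x ∈ F
  · rw [hd.union] at hx
    simp only [Finset.mem_union, shift, Finset.mem_image] at hx
    rcases hx with ((hx | ⟨y, hy, rfl⟩) | ⟨y, hy, rfl⟩) | ⟨y, hy, rfl⟩
    · rw [h.on₁ x hx, h'.on₁ x hx]
    · rw [h.on₂ y hy, h'.on₂ y hy]
    · rw [h.on₃ y hy, h'.on₃ y hy]
    · exact (h.on₄ y hy).trans (h'.on₄ y hy).symm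
  · rw [h.off x hx, h'.off x hx]

end glue

/-! ### The combined code, its dimension and its optimality. -/

namespace IsSpecial
variable {d N a c z : ℕ} {F : Finset (ℕ × ℕ)}

/-- A nonzero pair with `B ≠ 0` gets its rank from the staircase, one with `B = 0` from `D ≠ 0`. In
particular gluing is injective, so dimensions add. -/
theorem exists_combined_code (h : IsSpecial d N a c z F) (K : Type*) [Field K] [Finite K] (k : ℕ)
    (hk : k = z + min c a + ((cornerPart d N a F).filter fun x => x.2 ≤ N - d).card) :
    ∃ C : Submodule K (Matrix (Fin (N + d + c)) (Fin (a + N + 1)) K),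
      Module.finrank K C = k ∧
      (∀ A ∈ C, ∀ (i : Fin (N + d + c)) (j : Fin (a + N + 1)), ((i : ℕ), (j : ℕ)) ∉ F → A i j = 0) ∧
      (∀ A ∈ C, A ≠ 0 → d + 1 ≤ A.rank) ∧
      IsCombinedCode F k (d + 1) d a z 1 c 1 (N + d) (N + 1) C := by
  obtain ⟨C₄, hC₄⟩ := exists_code_of_long_last_col K N d h.pos h.le (cornerPart d N a F)
    h.isFerrers_cornerPart
    (fun i hm => (mem_cornerPart.1 hm).2.2.2 rfl)
    (fun i j hm hj => by
      rw [mem_cornerPart] at hm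
      by_contra hi
      have := (h.bottom i (j + a) (by omega) (by omega)).1 hm.2.2.1
      omega)
    (fun i j hi hj hjN => by
      have hd := h.pos
      rw [mem_cornerPart]
      refine ⟨by omega, by omega, ?_, by omega⟩
      by_cases hid : i < d
      · exact h.top _ _ hid (by omega)
      · exact h.middle_right _ _ (by omega) hi (by omega) (by omega))
  obtain ⟨F', φ, m', W, C', hF', hcomb, hsupp, hdim, hrank⟩ :=
    exists_code_of_rect_add_lines K d a z c h.pos h.wide h.z_le
  obtain ⟨δ', hδ', hC'⟩ := exists_isRankMetricCode (d + 1) C' fun B hB hne => (hrank B hB hne).1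
  let G : (C' × C₄) →ₗ[K] Matrix (Fin (N + d + c)) (Fin (a + N + 1)) K :=
    glue K d N a c z m' W φ ∘ₗ C'.subtype.prodMap C₄.subtype
  have hG : ∀ p, G p = glue K d N a c z m' W φ (p.1, p.2) := fun p => rfl
  have hglue : ∀ p : C' × C₄, IsGluing F (Finset.range d ×ˢ Finset.range a)
      (Finset.range z ×ˢ Finset.range 1) (Finset.range c ×ˢ Finset.range 1) (cornerPart d N a F)
      d a 1 φ (G p) (p.1 : Matrix (Fin m') (Fin W) K)
      (p.2 : Matrix (Fin (N + d)) (Fin (N + 1)) K) := fun p =>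
    isGluing_glue _ _ h (hC₄.support _ p.2.2)
  have hGrank : ∀ p, p ≠ 0 → d + 1 ≤ (G p).rank := by
    rintro ⟨⟨B, hB⟩, ⟨D, hD⟩⟩ hne
    by_cases hB0 : B = 0
    · subst hB0
      have hD0 : D ≠ 0 := by
        rintro rfl
        exact hne rfl
      have h1 := hC₄.le_dist D hD 0 C₄.zero_mem hD0
      rw [sub_zero] at h1
      exact h1.trans (rank_le_rank_glue_zero D h (hC₄.support D hD))
    · obtain ⟨-, e₂, e₃, h₂, h₃, hr, hB₂, hB₃⟩ := hrank B hB hB0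
      exact hr.trans (rank_add_le_rank_glue B D h e₂ e₃ h₂ h₃ hB₂ hB₃)
  have hGinj : Function.Injective G := by
    rw [← LinearMap.ker_eq_bot, LinearMap.ker_eq_bot']
    intro p hp
    by_contra hne
    have := hGrank p hne
    rw [hp, Matrix.rank_zero] at this
    omega
  refine ⟨LinearMap.range G, ?_, ?_, ?_, ?_⟩
  · rw [LinearMap.finrank_range_of_inj hGinj, Module.finrank_prod, hdim, hC₄.dim, hk]
  · rintro _ ⟨p, rfl⟩ i j hij
    exact (entry_fin (G p) i j).symm.trans ((hglue p).off _ hij)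
  · rintro _ ⟨p, rfl⟩ hne
    refine hGrank p ?_
    rintro rfl
    exact hne (map_zero G)
  -- The code on `F₁₂₃` enters with its true distance `δ' ≥ d + 1`; the corner code has distance
  -- exactly `d + 1`, which is therefore the minimum.
  · refine ⟨_, _, _, _, F', φ, m', W, z + min c a, _, δ', d + 1, C', C₄, h.isDecomposition, hcomb,
      ⟨hdim ▸ hC', hF', hsupp⟩, hC₄, hk, (min_eq_right hδ').symm, fun A => ⟨?_, ?_⟩⟩
    · rintro ⟨p, rfl⟩
      exact ⟨p.1, p.1.2, p.2, p.2.2, hglue p⟩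
    · rintro ⟨B, hB, D, hD, hA⟩
      exact ⟨(⟨B, hB⟩, ⟨D, hD⟩), (hglue (⟨B, hB⟩, ⟨D, hD⟩)).unique h.isDecomposition hA⟩

theorem card_image_add (P : Finset (ℕ × ℕ)) (x y : ℕ) :
    (P.image fun c => (c.1 + x, c.2 + y)).card = P.card := by
  refine Finset.card_image_of_injective _ ?_
  rintro ⟨i, j⟩ ⟨i', j'⟩ hij
  simp only [Prod.mk.injEq] at hij ⊢
  omega

theorem mem_subP {n δ y i j : ℕ} {F : Finset (ℕ × ℕ)} : (i, j) ∈ subP n δ y F ↔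
    i < y - δ ∧ j < y - δ + 1 ∧ (i + (δ - 1), j + (n - y)) ∈ F := by
  simp [subP, and_assoc]

theorem mem_subP_image (i j : ℕ) :
    (i, j) ∈ (subP (a + N + 1) (d + 1) (N + 1) F).image (fun c => (c.1 + d, c.2 + a)) ↔
      d ≤ i ∧ i < N ∧ a ≤ j ∧ j < a + (N - d) + 1 ∧ (i, j) ∈ F := by
  simp only [Finset.mem_image, Prod.exists, Prod.mk.injEq, mem_subP]
  have e : a + N + 1 - (N + 1) = a := by omega
  constructor
  · rintro ⟨x, y, h, rfl, rfl⟩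
    rw [e] at h
    exact ⟨by omega, by omega, by omega, by omega, h.2.2⟩
  · intro h
    refine ⟨i - d, j - a, ⟨by omega, by omega, ?_⟩, by omega, by omega⟩
    rw [show i - d + (d + 1 - 1) = i by omega, show j - a + (a + N + 1 - (N + 1)) = j by omega]
    exact h.2.2.2.2

/-- The information columns of the corner hold `d` full rows and `P` without its first column; those
missing `z` dots are the ones moved to `F₂`. -/
theorem card_cornerPart_filter (h : IsSpecial d N a c z F)
    (hz : z = colCount (subP (a + N + 1) (d + 1) (N + 1) F) 0) :
    z + ((cornerPart d N a F).filter fun x => x.2 ≤ N - d).card =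
      d * (N - d + 1) + (subP (a + N + 1) (d + 1) (N + 1) F).card := by
  have hd := h.pos
  have hdN := h.le
  set P := subP (a + N + 1) (d + 1) (N + 1) F with hP
  have e : a + N + 1 - (N + 1) = a := by omega
  have hset : (cornerPart d N a F).filter (fun x => x.2 ≤ N - d) =
      Finset.range d ×ˢ Finset.range (N - d + 1) ∪
        (P.filter fun x => ¬ x.2 = 0).image (fun c => (c.1 + d, c.2 + 0)) := by
    ext ⟨i, j⟩
    simp only [Finset.mem_filter, mem_cornerPart, Finset.mem_union, Finset.mem_product,
      Finset.mem_range, Finset.mem_image, Prod.exists, Prod.mk.injEq, hP, mem_subP, e]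
    constructor
    · rintro ⟨⟨hi, hj, hm, h0⟩, hj'⟩
      by_cases hid : i < d
      · exact Or.inl ⟨hid, by omega⟩
      · refine Or.inr ⟨i - d, j, ⟨⟨?_, by omega, ?_⟩, by omega⟩, by omega, rfl⟩
        · by_contra hiN
          have := (h.bottom i (j + a) (by omega) (by omega)).1 hm
          omega
        · rwa [show i - d + (d + 1 - 1) = i by omega]
    · rintro (⟨hi, hj⟩ | ⟨x, y, ⟨⟨hx, hy, hm⟩, h0⟩, rfl, rfl⟩)
      · exact ⟨⟨by omega, by omega, h.top _ _ hi (by omega), by omega⟩, by omega⟩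
      · exact ⟨⟨by omega, by omega, hm, by omega⟩, by omega⟩
  have hdisj : Disjoint (Finset.range d ×ˢ Finset.range (N - d + 1))
      ((P.filter fun x => ¬ x.2 = 0).image (fun c => (c.1 + d, c.2 + 0))) := by
    rw [Finset.disjoint_left]
    rintro ⟨i, j⟩ hm hm'
    simp only [Finset.mem_product, Finset.mem_range, Finset.mem_image, Prod.exists,
      Prod.mk.injEq] at hm hm'
    obtain ⟨x, y, -, rfl, -⟩ := hm'
    omega
  have hsum := Finset.card_filter_add_card_filter_not (s := P) (fun x => x.2 = 0)
  rw [hset, Finset.card_union_of_disjoint hdisj, card_image_add, Finset.card_product,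
    Finset.card_range, Finset.card_range, hz, colCount]
  omega

theorem boundCount_eq (h : IsSpecial d N a c z F) :
    boundCount (a + N + 1) F (d + 1) d =
      (N - d) * d + (subP (a + N + 1) (d + 1) (N + 1) F).card + (d + c) := by
  have hd := h.pos
  have hdN := h.le
  have hset : F.filter (fun x => d ≤ x.1 ∧ x.2 + (d + 1 - 1 - d) < a + N + 1) =
      (Finset.Ico d N ×ˢ Finset.Ico (a + N + 1 - d) (a + N + 1) ∪
        (subP (a + N + 1) (d + 1) (N + 1) F).image (fun c => (c.1 + d, c.2 + a))) ∪
      Finset.Ico N (N + d + c) ×ˢ Finset.Ico (a + N) (a + N + 1) := by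
    ext ⟨i, j⟩
    simp only [Finset.mem_filter, Finset.mem_union, Finset.mem_product, Finset.mem_Ico,
      mem_subP_image]
    constructor
    · rintro ⟨hm, hi, hj⟩
      have hb := h.ferrers.bounds _ _ hm
      by_cases hiN : i < N
      · by_cases hja : j < a
        · exact absurd hm (h.middle_left i j hi hiN hja)
        · by_cases hjd : a + N + 1 - d ≤ j
          · exact Or.inl (Or.inl (by omega))
          · exact Or.inl (Or.inr ⟨hi, hiN, by omega, by omega, hm⟩)
      · have := (h.bottom i j (by omega) (by omega)).1 hm
        exact Or.inr (by omega)
    · rintro ((hm | hm) | hm)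
      · exact ⟨h.middle_right i j hm.1.1 hm.1.2 hm.2.1 hm.2.2, by omega, by omega⟩
      · exact ⟨hm.2.2.2.2, by omega, by omega⟩
      · exact ⟨(h.bottom i j hm.1.1 hm.1.2).2 (by omega), by omega, by omega⟩
  have hdisj₁ : Disjoint (Finset.Ico d N ×ˢ Finset.Ico (a + N + 1 - d) (a + N + 1))
      ((subP (a + N + 1) (d + 1) (N + 1) F).image (fun c => (c.1 + d, c.2 + a))) := by
    rw [Finset.disjoint_left]
    rintro ⟨i, j⟩ hm hm'
    simp only [Finset.mem_product, Finset.mem_Ico, mem_subP_image] at hm hm'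
    omega
  have hdisj₂ : Disjoint (Finset.Ico d N ×ˢ Finset.Ico (a + N + 1 - d) (a + N + 1) ∪
        (subP (a + N + 1) (d + 1) (N + 1) F).image (fun c => (c.1 + d, c.2 + a)))
      (Finset.Ico N (N + d + c) ×ˢ Finset.Ico (a + N) (a + N + 1)) := by
    rw [Finset.disjoint_left]
    rintro ⟨i, j⟩ hm hm'
    simp only [Finset.mem_union, Finset.mem_product, Finset.mem_Ico, mem_subP_image] at hm hm'
    omega
  rw [boundCount, hset, Finset.card_union_of_disjoint hdisj₂,
    Finset.card_union_of_disjoint hdisj₁, card_image_add, Finset.card_product,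
    Finset.card_product, Nat.card_Ico, Nat.card_Ico, Nat.card_Ico, Nat.card_Ico,
    show a + N + 1 - (a + N + 1 - d) = d by omega, show N + d + c - N = d + c by omega,
    show a + N + 1 - (a + N) = 1 by omega, mul_one]

theorem boundCount_pred_eq (h : IsSpecial d N a c z F) :
    boundCount (a + N + 1) F (d + 1) (d - 1) =
      (N - d) * (d - 1) + (subP (a + N + 1) (d + 1) (N + 1) F).card + (a + N) := by
  have hd := h.pos
  have hdN := h.le
  have hset : F.filter (fun x => d - 1 ≤ x.1 ∧ x.2 + (d + 1 - 1 - (d - 1)) < a + N + 1) =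
      (Finset.Ico d N ×ˢ Finset.Ico (a + N + 1 - d) (a + N) ∪
        (subP (a + N + 1) (d + 1) (N + 1) F).image (fun c => (c.1 + d, c.2 + a))) ∪
      Finset.Ico (d - 1) d ×ˢ Finset.Ico 0 (a + N) := by
    ext ⟨i, j⟩
    simp only [Finset.mem_filter, Finset.mem_union, Finset.mem_product, Finset.mem_Ico,
      mem_subP_image]
    constructor
    · rintro ⟨hm, hi, hj⟩
      have hb := h.ferrers.bounds _ _ hm
      by_cases hid : i < d
      · exact Or.inr (by omega)
      · by_cases hiN : i < N
        · by_cases hja : j < a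
          · exact absurd hm (h.middle_left i j (by omega) hiN hja)
          · by_cases hjd : a + N + 1 - d ≤ j
            · exact Or.inl (Or.inl (by omega))
            · exact Or.inl (Or.inr ⟨by omega, hiN, by omega, by omega, hm⟩)
        · have := (h.bottom i j (by omega) (by omega)).1 hm
          omega
    · rintro ((hm | hm) | hm)
      · exact ⟨h.middle_right i j hm.1.1 hm.1.2 hm.2.1 (by omega), by omega, by omega⟩
      · exact ⟨hm.2.2.2.2, by omega, by omega⟩
      · exact ⟨h.top i j hm.1.2 (by omega), by omega, by omega⟩
  have hdisj₁ : Disjoint (Finset.Ico d N ×ˢ Finset.Ico (a + N + 1 - d) (a + N))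
      ((subP (a + N + 1) (d + 1) (N + 1) F).image (fun c => (c.1 + d, c.2 + a))) := by
    rw [Finset.disjoint_left]
    rintro ⟨i, j⟩ hm hm'
    simp only [Finset.mem_product, Finset.mem_Ico, mem_subP_image] at hm hm'
    omega
  have hdisj₂ : Disjoint (Finset.Ico d N ×ˢ Finset.Ico (a + N + 1 - d) (a + N) ∪
        (subP (a + N + 1) (d + 1) (N + 1) F).image (fun c => (c.1 + d, c.2 + a)))
      (Finset.Ico (d - 1) d ×ˢ Finset.Ico 0 (a + N)) := by
    rw [Finset.disjoint_left]
    rintro ⟨i, j⟩ hm hm'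
    simp only [Finset.mem_union, Finset.mem_product, Finset.mem_Ico, mem_subP_image] at hm hm'
    omega
  rw [boundCount, hset, Finset.card_union_of_disjoint hdisj₂,
    Finset.card_union_of_disjoint hdisj₁, card_image_add, Finset.card_product,
    Finset.card_product, Nat.card_Ico, Nat.card_Ico, Nat.card_Ico, Nat.card_Ico,
    show a + N - (a + N + 1 - d) = d - 1 by omega, show d - (d - 1) = 1 by omega,
    one_mul, Nat.sub_zero]

/-- The term `min c a` decides which bound is tight: deleting `d` rows if `c ≤ a`, deleting `d - 1`
rows and the last column if `c > a`. -/
theorem exists_optimal_code (h : IsSpecial d N a c z F) (K : Type*) [Field K] [Finite K]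
    (hz : z = colCount (subP (a + N + 1) (d + 1) (N + 1) F) 0) (k : ℕ)
    (hk : k = d * (N - d + 1) + (subP (a + N + 1) (d + 1) (N + 1) F).card + min c a) :
    ∃ C : Submodule K (Matrix (Fin (N + d + c)) (Fin (a + N + 1)) K),
      IsOptimalFDRMCode F k (d + 1) C ∧
      IsCombinedCode F k (d + 1) d a z 1 c 1 (N + d) (N + 1) C := by
  have hd := h.pos
  have hdN := h.le
  have hcard := h.card_cornerPart_filter hz
  obtain ⟨C, hdim, hsupp, hrank, hcomb⟩ := h.exists_combined_code K k (by omega)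
  refine ⟨C, ?_, hcomb⟩
  by_cases hca : c ≤ a
  · have hkb : k = boundCount (a + N + 1) F (d + 1) d := by
      rw [h.boundCount_eq, hk, min_eq_left hca]
      ring
    -- For distance `d + 2`, one more row is deleted, which loses the dot `(d, a + N)`.
    refine (isFDRMCode_of_boundCount_lt (i := d + 1) h.ferrers C hdim hsupp hrank le_rfl
      ?_).isOptimal (Nat.lt_succ_self d) hkb
    rw [hkb]
    refine Finset.card_lt_card ((Finset.ssubset_iff_of_subset ?_).2 ⟨(d, a + N), ?_, ?_⟩)
    · intro x hx
      rw [Finset.mem_filter] at hx ⊢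
      exact ⟨hx.1, by omega, by omega⟩
    · rw [Finset.mem_filter]
      exact ⟨h.last_col d (by omega), le_rfl, by simp only; omega⟩
    · intro hx
      have := (Finset.mem_filter.1 hx).2.1
      simp only at this
      omega
  · have hkb : k = boundCount (a + N + 1) F (d + 1) (d - 1) := by
      rw [h.boundCount_pred_eq, hk, min_eq_right (by omega)]
      obtain ⟨e, rfl⟩ := Nat.exists_eq_add_of_le hdN
      obtain ⟨b, rfl⟩ := Nat.exists_eq_add_of_le hd
      rw [Nat.add_sub_cancel_left, Nat.add_sub_cancel_left]
      ring
    -- Again one more row is deleted, still with one column, which loses the dot `(d - 1, 0)`.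
    refine (isFDRMCode_of_boundCount_lt (i := d) h.ferrers C hdim hsupp hrank (Nat.le_succ d)
      ?_).isOptimal (i := d - 1) (by omega) hkb
    rw [hkb]
    refine Finset.card_lt_card ((Finset.ssubset_iff_of_subset ?_).2 ⟨(d - 1, 0), ?_, ?_⟩)
    · intro x hx
      rw [Finset.mem_filter] at hx ⊢
      exact ⟨hx.1, by omega, by omega⟩
    · rw [Finset.mem_filter]
      exact ⟨h.top _ _ (by omega) (by omega), le_rfl, by simp only; omega⟩
    · intro hx
      have := (Finset.mem_filter.1 hx).2.1
      simp only at this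
      omega

end IsSpecial

/-! ### Reduction of the given shape to a special diagram. -/

theorem mem_iff_lt_card_of_isLowerSet {s : Finset ℕ} (hs : IsLowerSet (s : Set ℕ)) (i : ℕ) :
    i ∈ s ↔ i < s.card := by
  constructor
  · intro hi
    have hsub : Finset.range (i + 1) ⊆ s := fun j hj =>
      hs (Nat.le_of_lt_succ (Finset.mem_range.1 hj)) hi
    simpa using Finset.card_le_card hsub
  · intro hi
    by_contra hn
    have hsub : s ⊆ Finset.range i := fun j hj => by
      rw [Finset.mem_range]
      by_contra hij
      exact hn (hs (not_lt.1 hij) hj)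
    have := Finset.card_le_card hsub
    rw [Finset.card_range] at this
    omega

theorem IsFerrers.mem_of_le {m n : ℕ} {F : Finset (ℕ × ℕ)} (hF : IsFerrers m n F) {i i' j : ℕ}
    (hi : i' ≤ i) (h : (i, j) ∈ F) : (i', j) ∈ F := by
  induction i, hi using Nat.le_induction with
  | base => exact h
  | succ i _ ih => exact ih (hF.up _ _ h)

/-- The dots of column `a` below the first `d` rows are closed upwards, hence an initial segment
determined by its size. None lies in row `N` or below, where only column `a + N ≠ a` has dots. -/
theorem HasShape.isSpecial {d N a c : ℕ} {F : Finset (ℕ × ℕ)} (hd : 1 ≤ d) (hdN : d ≤ N)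
    (ha : d + 2 ≤ a) (hF : HasShape (N + d + c) (a + N + 1) (d + 1) (N + 1) F)
    (hz : colCount (subP (a + N + 1) (d + 1) (N + 1) F) 0 ≤ a) :
    IsSpecial d N a c (colCount (subP (a + N + 1) (d + 1) (N + 1) F) 0) F := by
  set P := subP (a + N + 1) (d + 1) (N + 1) F with hP
  let s := (Finset.range (N - d)).filter fun i => (i + d, a) ∈ F
  have hs : colCount P 0 = s.card := by
    rw [colCount]
    refine Finset.card_bij (fun x _ => x.1) ?_ ?_ ?_
    · rintro ⟨i, j⟩ hx
      simp only [Finset.mem_filter, hP, IsSpecial.mem_subP, s, Finset.mem_range] at hx ⊢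
      obtain ⟨⟨h1, h2, h3⟩, rfl⟩ := hx
      rw [show 0 + (a + N + 1 - (N + 1)) = a by omega] at h3
      exact ⟨by omega, h3⟩
    · rintro ⟨i, j⟩ hx ⟨i', j'⟩ hx' h
      have h1 := (Finset.mem_filter.1 hx).2
      have h2 := (Finset.mem_filter.1 hx').2
      simp only at h1 h2 h
      rw [h, h1, h2]
    · intro i hi
      simp only [Finset.mem_filter, s, Finset.mem_range] at hi
      refine ⟨(i, 0), ?_, rfl⟩
      simp only [Finset.mem_filter, hP, IsSpecial.mem_subP, and_true]
      rw [show 0 + (a + N + 1 - (N + 1)) = a by omega]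
      exact ⟨by omega, by omega, hi.2⟩
  have hlow : IsLowerSet (s : Set ℕ) := by
    intro i j hji hi
    simp only [s, Finset.coe_filter, Finset.mem_range, Set.mem_ofPred_eq] at hi ⊢
    exact ⟨by omega, hF.ferrers.mem_of_le (by omega) hi.2⟩
  have hle : s.card ≤ N - d := (Finset.card_filter_le _ _).trans (by simp)
  refine ⟨hd, hdN, ha, hz, hs ▸ hle, hF.ferrers, ?_, ?_, ?_, ?_, ?_⟩
  · intro i j hi hj
    exact hF.top i j (by omega) hj
  · intro i j hi hiN hj
    exact hF.middle_left i j (by omega) (by omega) (by omega)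
  · intro i j hi hiN hj hj'
    exact hF.middle_right i j (by omega) (by omega) (by omega) hj'
  · intro i j hi hi'
    rw [hF.bottom i j (by omega) hi']
    omega
  · intro i hi
    have h1 := mem_iff_lt_card_of_isLowerSet hlow (i - d)
    rw [← hs] at h1
    simp only [s, Finset.mem_filter, Finset.mem_range, Nat.sub_add_cancel hi] at h1
    constructor
    · intro hm
      have hb := hF.ferrers.bounds _ _ hm
      have hiN : i < N := by
        by_contra hiN
        have := (hF.bottom i a (by omega) hb.1).1 hm
        omega
      have := h1.1 ⟨by omega, hm⟩
      omega
    · intro hlt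
      exact (h1.2 (by omega)).2

/-- The shape forces `δ ≥ 2`: for `δ = 1` its first row could not be full. -/
theorem HasShape.one_lt {m n δ y : ℕ} {F : Finset (ℕ × ℕ)} (hm : 0 < m) (hδ : 0 < δ)
    (hyn : y + δ + 1 ≤ n) (hF : HasShape m n δ y F) : 1 < δ := by
  by_contra hlt
  have h0 := hF.ferrers.first_row hm 0 (by omega)
  by_cases hy : 0 < y - 1
  · exact hF.middle_left 0 0 (by omega) hy (by omega) h0
  · have := (hF.bottom 0 0 (by omega) hm).1 h0
    omega

end FDRM

theorem theorem4p9 {K : Type*} [Field K] [Finite K] (m n δ y : ℕ)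
    (hm : 0 < m) (hn : 0 < n) (hδ : 0 < δ)
    (hδy : δ ≤ y) (hym : (y : ℤ) ≤ min ((m : ℤ) - δ + 2) ((n : ℤ) - δ - 1))
    (F : Finset (ℕ × ℕ)) (hF : FDRM.HasShape m n δ y F)
    (hz : FDRM.colCount (FDRM.subP n δ y F) 0 ≤ n - y) :
    ∃ k : ℕ,
      (k : ℤ) = (if (m : ℤ) - n ≤ δ - 2 then
          (m : ℤ) - y + 1 + ((y : ℤ) - δ) * (δ - 1) + (FDRM.subP n δ y F).card
        else
          (n : ℤ) - 1 + ((y : ℤ) - δ) * (δ - 2) + (FDRM.subP n δ y F).card) ∧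
      ∃ C : Submodule K (Matrix (Fin m) (Fin n) K),
        FDRM.IsOptimalFDRMCode F k δ C ∧
        FDRM.IsCombinedCode F k δ
          (δ - 1) (n - y)
          (FDRM.colCount (FDRM.subP n δ y F) 0) 1
          (m + 2 - y - δ) 1
          (y + δ - 2) y C := by
  obtain ⟨h1, h2⟩ := le_min_iff.1 hym
  have hδ1 := hF.one_lt hm hδ (by omega)
  obtain ⟨d, rfl⟩ : ∃ d, δ = d + 1 := ⟨δ - 1, by omega⟩
  obtain ⟨N, rfl⟩ : ∃ N, y = N + 1 := ⟨y - 1, by omega⟩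
  obtain ⟨a, rfl⟩ : ∃ a, n = a + N + 1 := ⟨n - (N + 1), by omega⟩
  obtain ⟨c, rfl⟩ : ∃ c, m = N + d + c := ⟨m - (N + d), by omega⟩
  have ea : a + N + 1 - (N + 1) = a := by omega
  rw [ea] at hz ⊢
  rw [show d + 1 - 1 = d by omega, show N + d + c + 2 - (N + 1) - (d + 1) = c by omega,
    show N + 1 + (d + 1) - 2 = N + d by omega]
  have h := hF.isSpecial (by omega) (by omega) (by omega) hz
  refine ⟨_, ?_, h.exists_optimal_code K rfl _ rfl⟩
  obtain ⟨e, rfl⟩ : ∃ e, N = d + e := ⟨N - d, by omega⟩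
  rw [Nat.add_sub_cancel_left]
  -- In the new parameters the condition `m - n ≤ δ - 2` reads `c ≤ a`, so it selects the value of
  -- `min c a`.
  split_ifs with hc
  · rw [min_eq_left (by omega)]
    push_cast
    ring
  · rw [min_eq_right (by omega)]
    push_cast
    ring
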